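/- **Setting.** There are $n\ge 1$ agents. Agent $i$ has a local cost $f_i:\mathbb R^d\to\mathbb R$, $f_i(x)=\mathbb E[F_i(x;\xi_i)]$, where $F_i$ is differentiable in $x$. Put $f=\frac1n\sum_{i=1}^n f_i$. The agents run the adapt-then-combine gradient-tracking method with constant stepsize $\alpha>0$, $$x_i^{k+1}=\sum_{j=1}^n w_{ij}\,(x_j^k-\alpha g_j^k),\qquad g_i^{k+1}=\sum_{j=1}^n w_{ij}\bigl(g_j^k+\nabla F_j(x_j^{k+1};\xi_j^{k+1})-\nabla F_j(x_j^k;\xi_j^k)\bigr),$$ where $\xi_i^k$ is the data sampled by agent $i$ at iteration $k$, with a common deterministic starting point $x_i^0=x^0$ for all $i$ and $g_i^0=\nabla F_i(x_i^0;\xi_i^0)$. Write $\bar x^k=\frac1n\sum_i x_i^k$, let $\mathcal F^k$ be the $\sigma$-algebra generated by $x_i^0,\dots,x_i^k$ ($1\le i\le n$), and write $\|\mathbf x^k-\mathbf 1\otimes\bar x^k\|^2=\sum_i\|x_i^k-\bar x^k\|^2$. **Assumptions.** (1) $W=[w_{ij}]$ is doubly stochastic, primitive, symmetric and positive semidefinite;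 $\lambda=\|W-\frac1n\mathbf 1\mathbf 1^{\mathsf T}\|$ (spectral norm). (2) Each $f_i$ is differentiable with $L$-Lipschitz gradient and is $\mu$-strongly convex, where $L\ge\mu>0$. (3) For some $\sigma\ge0$, all $i$ and all $k\ge 0$: $\mathbb E[\nabla F_i(x_i^k;\xi_i^k)-\nabla f_i(x_i^k)\mid\mathcal F^k]=0$ and $\mathbb E[\|\nabla F_i(x_i^k;\xi_i^k)-\nabla f_i(x_i^k)\|^2\mid\mathcal F^k]\le\sigma^2$; and, conditionally on $\mathcal F^k$, the data $\xi_1^k,\dots,\xi_n^k$ are independent. **Theorem.** Let $L\ge\mu>0$. There are constants $C,c>0$ depending only on $L$ and $\mu$ with the following property. Let $x^\star$ be the minimizer of $f$, $a_0=\|x^0-x^\star\|^2$ and $\varsigma_\star^2=\frac1n\sum_{i=1}^n\|\nabla f_i(x^\star)\|^2$. For every such problem satisfying (1) and (2), every $\sigma\ge 0$ and every number of iterations $K\ge1$, there exists a constant stepsize $\alpha>0$ such that, whenever the method run with stepsize $\alpha$ satisfies (3), the expectations below are finite and $$\mathbb E\|\bar x^K-x^\star\|^2+\frac1n\,\mathbb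 E\|\mathbf x^K-\mathbf 1\otimes\bar x^K\|^2\le C\left(\frac{\ell\,\sigma^2}{nK}+\frac{\ell^2\,\sigma^2}{(1-\lambda)K^2}+\frac{\ell^3\,\sigma^2}{(1-\lambda)^2nK^3}+(a_0+\varsigma_\star^2)\,e^{-c(1-\lambda)K}\right),$$ where $\ell=\log\bigl(2+nK(a_0+\varsigma_\star^2)/\sigma^2\bigr)$ (when $\sigma=0$ the first three terms are $0$). In particular the logarithmic factor $\ell$ does not depend on $\lambda$, and the exponential term carries no $1/(1-\lambda)$ multiplier. -/

import Mathlib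

open MeasureTheory

noncomputable section

/-- The decision space `ℝ^d` with its Euclidean norm. -/
abbrev RVec (d : ℕ) : Type := EuclideanSpace ℝ (Fin d)

/-- The average of the `n` blocks of a stacked vector. -/
def blockAvg {n d : ℕ} (x : Fin n → RVec d) : RVec d :=
  (1 / (n : ℝ)) • ∑ i, x i

/-- The squared consensus error `‖x - 1 ⊗ x̄‖²` of a stacked vector. -/
def consensusErrorSq {n d : ℕ} (x : Fin n → RVec d) : ℝ :=
  ∑ i, ‖x i - blockAvg x‖ ^ 2

/-- The weight matrix is doubly stochastic, primitive, symmetric and positive semidefinite. -/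
structure IsGossipMatrix {n : ℕ} (W : Matrix (Fin n) (Fin n) ℝ) : Prop where
  doublyStochastic : W ∈ doublyStochastic ℝ (Fin n)
  primitive : W.IsPrimitive
  symm : W.IsSymm
  posSemidef : W.PosSemidef

/-- The mixing rate `λ = ‖W - (1/n) 1 1ᵀ‖` (spectral norm). -/
def mixingRate {n : ℕ} (W : Matrix (Fin n) (Fin n) ℝ) : ℝ :=
  ‖Matrix.toEuclideanCLM (n := Fin n) (𝕜 := ℝ) (W - Matrix.of fun _ _ => 1 / (n : ℝ))‖

/-- `f` is differentiable, its gradient is `L`-Lipschitz, and `f` is `μ`-strongly convex. -/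
structure IsSmoothStronglyConvex {d : ℕ} (L μ : ℝ) (f : RVec d → ℝ) : Prop where
  differentiable : Differentiable ℝ f
  smooth : ∀ y z, ‖gradient f y - gradient f z‖ ≤ L * ‖y - z‖
  strongConvex : StrongConvexOn Set.univ μ f

/-- The local cost `f_i(x) = 𝔼 F_i(x; ξ_i)`, where `D` is the law of `ξ_i`. -/
def localCost {d : ℕ} {Ξ : Type*} [MeasurableSpace Ξ] (D : Measure Ξ) (F : RVec d → Ξ → ℝ) :
    RVec d → ℝ :=
  fun x => ∫ s, F x s ∂D

/-- The stochastic gradient `∇F_i(x; s)`: gradient in the decision variable. -/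
def stochGrad {d : ℕ} {Ξ : Type*} (F : RVec d → Ξ → ℝ) (x : RVec d) (s : Ξ) : RVec d :=
  gradient (fun y => F y s) x

/-- `F` is a random loss whose expectation exists, which is differentiable in the decision
variable and has a (jointly) measurable stochastic gradient. -/
structure IsStochasticLoss {d : ℕ} {Ξ : Type*} [MeasurableSpace Ξ] (D : Measure Ξ)
    (F : RVec d → Ξ → ℝ) : Prop where
  integrable : ∀ x, Integrable (F x) D
  differentiable : ∀ s, Differentiable ℝ fun x => F x s
  measurable_grad : Measurable fun p : RVec d × Ξ => stochGrad F p.1 p.2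

/-- The adapt-then-combine gradient-tracking method with stepsize `α`, weight matrix `W`,
initialization `x0` and data `s i k` sampled by agent `i` at iteration `k`.  The state after
`k` iterations is the pair `(x^k, g^k)`.  (Since `w_ij = 0` unless `j` is a neighbor of `i`, the
sums may run over all agents.) -/
def atcGT {n d : ℕ} {Ξ : Fin n → Type*} (W : Matrix (Fin n) (Fin n) ℝ) (α : ℝ)
    (F : ∀ i, RVec d → Ξ i → ℝ) (x0 : Fin n → RVec d) (s : ∀ i, ℕ → Ξ i) :
    ℕ → (Fin n → RVec d) × (Fin n → RVec d)
  | 0 => (x0, fun i => stochGrad (F i) (x0 i) (s i 0))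
  | k + 1 =>
    let x := (atcGT W α F x0 s k).1
    let g := (atcGT W α F x0 s k).2
    let x' : Fin n → RVec d := fun i => ∑ j, W i j • (x j - α • g j)
    (x', fun i => ∑ j, W i j •
      (g j + stochGrad (F j) (x' j) (s j (k + 1)) - stochGrad (F j) (x j) (s j k)))

/-- The random iterate `x^k` of the method, when the data are random. -/
def gtIterate {n d : ℕ} {Ξ : Fin n → Type*} {Ω : Type*} (W : Matrix (Fin n) (Fin n) ℝ) (α : ℝ)
    (F : ∀ i, RVec d → Ξ i → ℝ) (x0 : Fin n → RVec d) (ξ : ∀ i, ℕ → Ω → Ξ i)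
    (k : ℕ) (ω : Ω) : Fin n → RVec d :=
  (atcGT W α F x0 (fun i t => ξ i t ω) k).1

/-- The σ-algebra generated by the stacked vectors `x^0, …, x^k`. -/
abbrev historySigma {n d : ℕ} {Ω : Type*} (x : ℕ → Ω → (Fin n → RVec d)) (k : ℕ) :
    MeasurableSpace Ω :=
  ⨆ t ∈ Set.Iic k, MeasurableSpace.comap (x t) inferInstance

/-- The random elements `X i` are conditionally independent given the σ-algebra `m`:
`P(⋂ {X i ∈ A i} | m) = ∏ P(X i ∈ A i | m)` almost surely. (This is the standard definition; it is
spelled out so as not to require the sample space to be standard Borel.) -/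
def CondIndepGiven {ι Ω : Type*} {Ξ : ι → Type*} [∀ i, MeasurableSpace (Ξ i)]
    (m : MeasurableSpace Ω) [mΩ : MeasurableSpace Ω] (P : Measure Ω) (X : ∀ i, Ω → Ξ i) : Prop :=
  ∀ (S : Finset ι) (A : ∀ i, Set (Ξ i)), (∀ i ∈ S, MeasurableSet (A i)) →
    P[(⋂ i ∈ S, X i ⁻¹' A i).indicator (fun _ => (1 : ℝ)) | m]
      =ᵐ[P] ∏ i ∈ S, P[(X i ⁻¹' A i).indicator (fun _ => (1 : ℝ)) | m]

/-- The gradient-noise assumption along iterates `x^k` with data `ξ i k`, costs `f i`, losses `F i`: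
with `ℱ^k = σ(x^0, …, x^k)` and `v_i^k = ∇F_i(x_i^k; ξ_i^k) - ∇f_i(x_i^k)`,
`𝔼[v_i^k | ℱ^k] = 0` and `𝔼[‖v_i^k‖² | ℱ^k] ≤ σ²`, and the data of the different agents at
iteration `k` are independent conditionally on `ℱ^k`.  Square integrability of `v_i^k` is part of
the meaning of the conditional second moment bound. -/
structure GradientNoise {n d : ℕ} {Ξ : Fin n → Type*} [∀ i, MeasurableSpace (Ξ i)]
    {Ω : Type*} [MeasurableSpace Ω] (P : Measure Ω) (f : Fin n → RVec d → ℝ)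
    (F : ∀ i, RVec d → Ξ i → ℝ) (x : ℕ → Ω → (Fin n → RVec d)) (ξ : ∀ i, ℕ → Ω → Ξ i)
    (σ : ℝ) : Prop where
  memLp : ∀ i k, MemLp
    (fun ω => stochGrad (F i) (x k ω i) (ξ i k ω) - gradient (f i) (x k ω i)) 2 P
  unbiased : ∀ i k,
    P[fun ω => stochGrad (F i) (x k ω i) (ξ i k ω) - gradient (f i) (x k ω i) | historySigma x k]
      =ᵐ[P] 0
  variance_le : ∀ i k,
    P[fun ω => ‖stochGrad (F i) (x k ω i) (ξ i k ω) - gradient (f i) (x k ω i)‖ ^ 2 |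
        historySigma x k]
      ≤ᵐ[P] fun _ => σ ^ 2
  condIndep : ∀ k, CondIndepGiven (historySigma x k) P (fun i => ξ i k)

/-- The logarithmic factor `log (2 + n K (a₀ + ς²) / σ²)` hidden in the `Õ` notation
(it equals `log 2` when `σ = 0`, where it only multiplies zero). -/
def gtLogFactor (n K : ℕ) (σ a₀ ςsq : ℝ) : ℝ :=
  Real.log (2 + n * K * (a₀ + ςsq) / σ ^ 2)

end

/-! Let J be the averaging matrix and A = (W − J) ⊗ I. Since W is positive semidefinite and
primitive, A is a positive operator of norm λ < 1 (`isPosContraction_mixOp`, `mixingRate_lt_one`).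

The average of the trackers equals the average of the stochastic gradients, so x̄ performs inexact
stochastic gradient descent. Its mean-square error contracts by 1 − αμ, up to a multiple of α times
the consensus error and a noise term α²σ²/n (`IsNoisyTracking.mean_recursion`). The factor 1/n holds
because the noises of different agents are uncorrelated (`integral_inner_eq_zero_of_condIndep`).

For the consensus error, the trackers are replaced by the sums S_0 = 0, S_{k+1} = A S_k + A² G_{k+1}
(`mixedSum`), where G_k stacks the stochastic gradients. The centered iterates c_k satisfy c_{k+2} =
A c_{k+1} + α(1 − A) S_k − α A² G_{k+1}. This has two advantages. First, S_k is a function of x^0,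
…, x^{k+1}, so the noise in G_{k+1} is orthogonal to it, whereas the tracker at step k contains the
data of step k. Second, the map (x, s) ↦ (A x + (1 − A) s, A s) contracts ‖x‖² + 2‖s‖² by (1 + λ)/2
(`IsPosContraction.lyapunov_le`), a form whose weights do not depend on λ. Recentering S_k at the
solution s of (1 − A) s = A² ∇f(x*) (gradients stacked) leaves only gradient differences, controlled
by L, plus noise; the stationary noise level is of order α²σ²/(1 − λ)
(`IsNoisyTracking.consensus_recursion`).

Initially the form contains α‖s‖, at most α/(1 − λ) times the norm of the stacked gradients at x*.
As α is at most a constant times 1 − λ, the factor 1/(1 − λ) disappears, and the exponential term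
has no such multiplier.

Coupling both recursions (`tracking_rate`) gives, up to a constant, (a₀ + ς²)(1 − αμ/2)^K + ασ²/n +
α²σ²/(1 − λ). `exists_stepsize` takes α as the smaller of a multiple of 1 − λ and 2ℓ/(μK); the
prefactor is free of λ, hence so is ℓ. The term in ℓ³ of the statement is only slack. -/

noncomputable section

/-! ### Positive contractions and their Lyapunov form -/

section Hilbert

variable {E : Type*} [NormedAddCommGroup E] [InnerProductSpace ℝ E]

/-- A self-adjoint positive semidefinite operator with `‖A z‖ ≤ r ‖z‖`. -/
structure IsPosContraction (A : E →L[ℝ] E) (r : ℝ) : Prop where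
  symm : ∀ x y, inner ℝ (A x) y = inner ℝ x (A y)
  nonneg : ∀ x, 0 ≤ inner ℝ (A x) x
  bound : ∀ x, ‖A x‖ ≤ r * ‖x‖
  rate_nonneg : 0 ≤ r

namespace IsPosContraction

variable {A : E →L[ℝ] E} {r : ℝ}

lemma inner_le (hA : IsPosContraction A r) (z : E) : inner ℝ (A z) z ≤ r * ‖z‖ ^ 2 := by
  have h := real_inner_le_norm (A z) z
  nlinarith [hA.bound z, norm_nonneg z]

/-- This is A² ≤ A for 0 ≤ A ≤ 1, obtained without spectral calculus by testing positivity of A on z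
− A z. -/
lemma norm_sq_le_inner (hA : IsPosContraction A r) (hr : r ≤ 1) (z : E) :
    ‖A z‖ ^ 2 ≤ inner ℝ (A z) z := by
  have h := hA.nonneg (z - A z)
  have h2 : inner ℝ (A (A z)) (A z) ≤ ‖A z‖ ^ 2 := by
    have := hA.inner_le (A z)
    nlinarith [sq_nonneg ‖A z‖]
  have h3 : inner ℝ (A (A z)) z = ‖A z‖ ^ 2 := by rw [hA.symm, real_inner_self_eq_norm_sq]
  rw [map_sub, inner_sub_left, inner_sub_right, inner_sub_right, real_inner_self_eq_norm_sq,
    h3] at h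
  linarith

lemma norm_le (hA : IsPosContraction A r) (hr : r ≤ 1) (z : E) : ‖A z‖ ≤ ‖z‖ :=
  (hA.bound z).trans (mul_le_of_le_one_left (norm_nonneg _) hr)

/-- The pair `(x, s) ↦ (A x + (1 - A) s, A s)` contracts the form `‖x‖² + 2 ‖s‖²`. -/
lemma lyapunov_le (hA : IsPosContraction A r) (hr : r ≤ 1) (x s : E) :
    ‖A x + (s - A s)‖ ^ 2 + 2 * ‖A s‖ ^ 2 ≤ (1 + r) / 2 * (‖x‖ ^ 2 + 2 * ‖s‖ ^ 2) := by
  -- After this rewriting, ‖A(x − s)‖² ≤ ⟨A(x − s), x − s⟩ makes the terms ⟨s, A x⟩ cancel and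
  -- leaves ‖s‖² − ⟨A s, s⟩ + ⟨A x, x⟩. The weight 2 on ‖A s‖² ≤ ⟨A s, s⟩ then gives at most (1 +
  -- r)‖s‖² + r‖x‖².
  have e1 : A x + (s - A s) = s + A (x - s) := by rw [map_sub]; abel
  have h1 := norm_add_sq_real s (A (x - s))
  have h2 := hA.norm_sq_le_inner hr (x - s)
  have h3 := hA.inner_le x
  have h4 := hA.inner_le s
  have h5 := hA.norm_sq_le_inner hr s
  have h6 : inner ℝ (A (x - s)) (x - s)
      = inner ℝ (A x) x - 2 * inner ℝ s (A x) + inner ℝ (A s) s := by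
    rw [map_sub, inner_sub_left, inner_sub_right, inner_sub_right, hA.symm s x,
      real_inner_comm s (A x)]
    ring
  have h7 : inner ℝ s (A (x - s)) = inner ℝ s (A x) - inner ℝ (A s) s := by
    rw [map_sub, inner_sub_right, real_inner_comm s (A s)]
  rw [e1, h1]
  nlinarith

lemma sub_bound (hA : IsPosContraction A r) (z : E) : (1 - r) * ‖z‖ ≤ ‖z - A z‖ := by
  have h := norm_sub_norm_le z (A z)
  nlinarith [hA.bound z]

/-- If `r < 1`, then `1 - A` is onto, with a preimage bounded by `1 / (1 - r)`. -/
lemma exists_preimage [FiniteDimensional ℝ E] (hA : IsPosContraction A r) (hr : r < 1) (b : E) :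
    ∃ z, z - A z = b ∧ (1 - r) * ‖z‖ ≤ ‖b‖ := by
  have hinj : Function.Injective ((LinearMap.id : E →ₗ[ℝ] E) - (A : E →ₗ[ℝ] E)) := by
    rw [← LinearMap.ker_eq_bot, LinearMap.ker_eq_bot']
    intro z hz
    have hz' : z - A z = 0 := by simpa using hz
    have := hA.sub_bound z
    rw [hz', norm_zero] at this
    have h0 : ‖z‖ ≤ 0 := by nlinarith [norm_nonneg z]
    exact norm_le_zero_iff.1 h0
  obtain ⟨z, hz⟩ := (LinearMap.injective_iff_surjective.1 hinj) b
  have hz' : z - A z = b := by simpa using hz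
  exact ⟨z, hz', hz' ▸ hA.sub_bound z⟩

/-- One step of the perturbed contraction. -/
lemma lyapunov_perturbed_le (hA : IsPosContraction A r) (hr : r < 1) (x s d : E) :
    ‖A x + (s - A s) - A (A d)‖ ^ 2 + 2 * ‖A s + A (A d)‖ ^ 2
      ≤ (1 - (1 - r) / 4) * (‖x‖ ^ 2 + 2 * ‖s‖ ^ 2) + 15 / (1 - r) * ‖d‖ ^ 2 := by
  have hr0 := hA.rate_nonneg
  -- Young's inequality with parameter (1 − r)/4, small enough to keep half of the contraction gap
  -- (1 − r)/2. The constant 15 is 5 times the total weight 1 + 2 of the form.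
  have key : ∀ p q : E, ‖p + q‖ ^ 2 ≤ (1 + (1 - r) / 4) * ‖p‖ ^ 2 + 5 / (1 - r) * ‖q‖ ^ 2 := by
    intro p q
    have hδ : 0 < 1 - r := by linarith
    have h1 := norm_add_sq_real p q
    have h2 := real_inner_le_norm p q
    have h3 : 2 * (‖p‖ * ‖q‖) ≤ (1 - r) / 4 * ‖p‖ ^ 2 + 4 / (1 - r) * ‖q‖ ^ 2 := by
      have : (1 - r) / 4 * ‖p‖ ^ 2 + 4 / (1 - r) * ‖q‖ ^ 2 - 2 * (‖p‖ * ‖q‖)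
          = ((1 - r) * ‖p‖ - 4 * ‖q‖) ^ 2 / (4 * (1 - r)) := by field_simp; ring
      have h4 : 0 ≤ ((1 - r) * ‖p‖ - 4 * ‖q‖) ^ 2 / (4 * (1 - r)) := by positivity
      linarith
    have h5 : ‖q‖ ^ 2 ≤ 1 / (1 - r) * ‖q‖ ^ 2 := by
      have : 1 ≤ 1 / (1 - r) := by rw [le_div_iff₀ hδ]; linarith
      nlinarith [sq_nonneg ‖q‖]
    have h6 : 5 / (1 - r) * ‖q‖ ^ 2 = 4 / (1 - r) * ‖q‖ ^ 2 + 1 / (1 - r) * ‖q‖ ^ 2 := by ring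
    linarith
  have h1 := key (A x + (s - A s)) (-A (A d))
  have h2 := key (A s) (A (A d))
  have h3 := hA.lyapunov_le hr.le x s
  have hAd : ‖A (A d)‖ ≤ ‖d‖ := (hA.norm_le hr.le _).trans (hA.norm_le hr.le _)
  have hAd2 : ‖A (A d)‖ ^ 2 ≤ ‖d‖ ^ 2 := pow_le_pow_left₀ (norm_nonneg _) hAd 2
  rw [← sub_eq_add_neg, norm_neg] at h1
  have hδ : 0 < 1 - r := by linarith
  have h4 : 5 / (1 - r) * ‖A (A d)‖ ^ 2 ≤ 5 / (1 - r) * ‖d‖ ^ 2 := by gcongr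
  have h5 : (1 + (1 - r) / 4) * ((1 + r) / 2) ≤ 1 - (1 - r) / 4 := by nlinarith
  have h6 : 0 ≤ ‖x‖ ^ 2 + 2 * ‖s‖ ^ 2 := by positivity
  have h7 : 15 / (1 - r) * ‖d‖ ^ 2 = 3 * (5 / (1 - r) * ‖d‖ ^ 2) := by ring
  have h8 : (1 + (1 - r) / 4) * (‖A x + (s - A s)‖ ^ 2 + 2 * ‖A s‖ ^ 2)
      ≤ (1 + (1 - r) / 4) * ((1 + r) / 2 * (‖x‖ ^ 2 + 2 * ‖s‖ ^ 2)) := by gcongr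
  have h9 := mul_le_mul_of_nonneg_right h5 h6
  linarith

end IsPosContraction

end Hilbert

/-! ### Stacked vectors and the block action of matrices -/

section Gossip

variable {n d : ℕ}

/-- Stacked vectors `(ℝ^d)^n` with the Euclidean norm. -/
def Stacked (n d : ℕ) : Type := PiLp 2 (fun _ : Fin n => RVec d)

namespace Stacked

instance : NormedAddCommGroup (Stacked n d) :=
  inferInstanceAs (NormedAddCommGroup (PiLp 2 (fun _ : Fin n => RVec d)))

instance : InnerProductSpace ℝ (Stacked n d) :=
  inferInstanceAs (InnerProductSpace ℝ (PiLp 2 (fun _ : Fin n => RVec d)))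

instance : FiniteDimensional ℝ (Stacked n d) :=
  inferInstanceAs (FiniteDimensional ℝ (PiLp 2 (fun _ : Fin n => RVec d)))

instance : MeasurableSpace (Stacked n d) := borel _

instance : BorelSpace (Stacked n d) := ⟨rfl⟩

/-- The stacked vector with given blocks. -/
def mk (x : Fin n → RVec d) : Stacked n d := WithLp.toLp 2 x

/-- The blocks of a stacked vector. -/
def blocks (x : Stacked n d) : Fin n → RVec d := WithLp.ofLp x

@[simp] lemma blocks_mk (x : Fin n → RVec d) : (mk x).blocks = x := rfl

@[ext] lemma ext {x y : Stacked n d} (h : ∀ i, x.blocks i = y.blocks i) : x = y :=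
  WithLp.ofLp_injective 2 (funext h)

@[simp] lemma blocks_add (x y : Stacked n d) : (x + y).blocks = x.blocks + y.blocks := rfl

@[simp] lemma blocks_sub (x y : Stacked n d) : (x - y).blocks = x.blocks - y.blocks := rfl

@[simp] lemma blocks_smul (c : ℝ) (x : Stacked n d) : (c • x).blocks = c • x.blocks := rfl

lemma inner_eq (x y : Stacked n d) :
    inner ℝ x y = ∑ i, inner ℝ (x.blocks i) (y.blocks i) :=
  PiLp.inner_apply (𝕜 := ℝ) (f := fun _ : Fin n => RVec d) x y

lemma norm_sq_eq (x : Stacked n d) : ‖x‖ ^ 2 = ∑ i, ‖x.blocks i‖ ^ 2 := by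
  rw [← real_inner_self_eq_norm_sq, inner_eq]
  simp only [real_inner_self_eq_norm_sq]

lemma continuous_mk : Continuous (mk : (Fin n → RVec d) → Stacked n d) :=
  PiLp.continuous_toLp 2 (fun _ : Fin n => RVec d)

lemma continuous_blocks : Continuous (blocks : Stacked n d → Fin n → RVec d) :=
  PiLp.continuous_ofLp 2 (fun _ : Fin n => RVec d)

lemma measurable_mk : Measurable (mk : (Fin n → RVec d) → Stacked n d) :=
  continuous_mk.measurable

end Stacked

/-- The action `M ⊗ I` of an `n × n` matrix on stacked vectors, as a linear map. -/
def blockLin (M : Matrix (Fin n) (Fin n) ℝ) : Stacked n d →ₗ[ℝ] Stacked n d where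
  toFun x := Stacked.mk fun i => ∑ j, M i j • x.blocks j
  map_add' x y := by
    ext1 i
    simp only [Stacked.blocks_add, Stacked.blocks_mk, Pi.add_apply, smul_add,
      Finset.sum_add_distrib]
  map_smul' c x := by
    ext1 i
    simp only [Stacked.blocks_smul, Stacked.blocks_mk, Pi.smul_apply, Finset.smul_sum,
      smul_comm c, RingHom.id_apply]

/-- The action `M ⊗ I` of an `n × n` matrix on stacked vectors. -/
def blockOp (M : Matrix (Fin n) (Fin n) ℝ) : Stacked n d →L[ℝ] Stacked n d :=
  ⟨blockLin M, LinearMap.continuous_of_finiteDimensional _⟩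

@[simp] lemma blocks_blockOp (M : Matrix (Fin n) (Fin n) ℝ) (x : Stacked n d) (i : Fin n) :
    (blockOp M x).blocks i = ∑ j, M i j • x.blocks j := rfl

lemma blockOp_mul (M N : Matrix (Fin n) (Fin n) ℝ) (x : Stacked n d) :
    blockOp (M * N) x = blockOp M (blockOp N x) := by
  ext1 i
  simp only [blocks_blockOp, Matrix.mul_apply, Finset.smul_sum, Finset.sum_smul, smul_smul]
  rw [Finset.sum_comm]

lemma blockOp_one (x : Stacked n d) : blockOp 1 x = x := by
  ext1 i
  simp [Matrix.one_apply]

lemma blockOp_sub (M N : Matrix (Fin n) (Fin n) ℝ) (x : Stacked n d) :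
    blockOp (M - N) x = blockOp M x - blockOp N x := by
  ext1 i
  simp [sub_smul]

/-- The vector of the `c`-th coordinates of all blocks. -/
def blockCol (c : Fin d) (x : Stacked n d) : EuclideanSpace ℝ (Fin n) :=
  WithLp.toLp 2 fun i => x.blocks i c

/-- Slicing by coordinate turns M ⊗ I into d independent copies of M, so inequalities for M can be
summed over slices. -/
lemma inner_eq_sum_blockCol (x y : Stacked n d) :
    inner ℝ x y = ∑ c, inner ℝ (blockCol c x) (blockCol c y) := by
  simp only [Stacked.inner_eq, PiLp.inner_apply, blockCol]
  rw [Finset.sum_comm]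

lemma norm_sq_eq_sum_blockCol (x : Stacked n d) : ‖x‖ ^ 2 = ∑ c, ‖blockCol c x‖ ^ 2 := by
  rw [← real_inner_self_eq_norm_sq, inner_eq_sum_blockCol]
  simp only [real_inner_self_eq_norm_sq]

lemma blockCol_blockOp (M : Matrix (Fin n) (Fin n) ℝ) (c : Fin d) (x : Stacked n d) :
    blockCol c (blockOp M x) = Matrix.toEuclideanCLM (n := Fin n) (𝕜 := ℝ) M (blockCol c x) := by
  rw [blockCol, blockCol, Matrix.toEuclideanCLM_toLp]
  ext i
  simp [Matrix.mulVec, dotProduct]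

/-- Operator inequalities pass from a matrix to its action on stacked vectors. -/
lemma IsPosContraction.matrix_action {M : Matrix (Fin n) (Fin n) ℝ} {r : ℝ}
    (hM : IsPosContraction (Matrix.toEuclideanCLM (n := Fin n) (𝕜 := ℝ) M) r) :
    IsPosContraction (blockOp M : Stacked n d →L[ℝ] Stacked n d) r where
  symm x y := by
    simp only [inner_eq_sum_blockCol, blockCol_blockOp, hM.symm]
  nonneg x := by
    rw [inner_eq_sum_blockCol]
    exact Finset.sum_nonneg fun c _ => by rw [blockCol_blockOp]; exact hM.nonneg _
  bound x := by
    refine le_of_sq_le_sq ?_ (mul_nonneg hM.rate_nonneg (norm_nonneg _))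
    rw [mul_pow, norm_sq_eq_sum_blockCol, norm_sq_eq_sum_blockCol x, Finset.mul_sum]
    refine Finset.sum_le_sum fun c _ => ?_
    rw [blockCol_blockOp, ← mul_pow]
    exact pow_le_pow_left₀ (norm_nonneg _) (hM.bound _) 2
  rate_nonneg := hM.rate_nonneg

end Gossip

/-! ### Averaging and the spectral gap of gossip matrices -/

section Gossip

variable {n d : ℕ}

/-- The averaging matrix `(1/n) 1 1ᵀ`. -/
def avgMatrix (n : ℕ) : Matrix (Fin n) (Fin n) ℝ := Matrix.of fun _ _ => 1 / (n : ℝ)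

lemma avgMatrix_mul_self (hn : 0 < n) : avgMatrix n * avgMatrix n = avgMatrix n := by
  ext i j
  simp [avgMatrix, Matrix.mul_apply]
  field_simp

lemma avgMatrix_conjTranspose : (avgMatrix n).conjTranspose = avgMatrix n := by
  ext i j
  simp [avgMatrix]

lemma mul_avgMatrix {W : Matrix (Fin n) (Fin n) ℝ} (hW : W ∈ doublyStochastic ℝ (Fin n)) :
    W * avgMatrix n = avgMatrix n := by
  ext i j
  simp only [avgMatrix, Matrix.mul_apply, Matrix.of_apply]
  rw [← Finset.sum_mul, sum_row_of_mem_doublyStochastic hW, one_mul]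

lemma avgMatrix_mul {W : Matrix (Fin n) (Fin n) ℝ} (hW : W ∈ doublyStochastic ℝ (Fin n)) :
    avgMatrix n * W = avgMatrix n := by
  ext i j
  simp only [avgMatrix, Matrix.mul_apply, Matrix.of_apply]
  rw [← Finset.mul_sum, sum_col_of_mem_doublyStochastic hW, mul_one]

/-- Since W J = J W = J² = J, conjugating W by the projection 1 − J subtracts J exactly. Positivity
of W therefore survives. -/
lemma sub_avgMatrix_eq (hn : 0 < n) {W : Matrix (Fin n) (Fin n) ℝ}
    (hW : W ∈ doublyStochastic ℝ (Fin n)) :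
    W - avgMatrix n = (1 - avgMatrix n).conjTranspose * W * (1 - avgMatrix n) := by
  rw [Matrix.conjTranspose_sub, Matrix.conjTranspose_one, avgMatrix_conjTranspose, sub_mul,
    mul_sub, mul_one, one_mul, sub_mul, avgMatrix_mul hW, mul_avgMatrix hW,
    avgMatrix_mul_self hn]
  abel

lemma sub_avgMatrix_posSemidef (hn : 0 < n) {W : Matrix (Fin n) (Fin n) ℝ}
    (hW : IsGossipMatrix W) : (W - avgMatrix n).PosSemidef := by
  rw [sub_avgMatrix_eq hn hW.doublyStochastic]
  exact hW.posSemidef.conjTranspose_mul_mul_same _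

lemma mixingRate_eq (W : Matrix (Fin n) (Fin n) ℝ) :
    mixingRate W = ‖Matrix.toEuclideanCLM (n := Fin n) (𝕜 := ℝ) (W - avgMatrix n)‖ := rfl

/-- Doubly stochastic matrices do not increase the sum of squares. -/
lemma sum_sq_mulVec_le {W : Matrix (Fin n) (Fin n) ℝ} (hW : W ∈ doublyStochastic ℝ (Fin n))
    (z : Fin n → ℝ) : ∑ i, (∑ j, W i j * z j) ^ 2 ≤ ∑ j, z j ^ 2 := by
  have h1 : ∀ i, (∑ j, W i j * z j) ^ 2 ≤ ∑ j, W i j * z j ^ 2 := fun i => by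
    have := (even_two.convexOn_pow (𝕜 := ℝ)).map_sum_le (t := Finset.univ) (w := W i) (p := z)
      (fun j _ => nonneg_of_mem_doublyStochastic hW)
      (sum_row_of_mem_doublyStochastic hW i) (fun _ _ => Set.mem_univ _)
    simpa using this
  calc ∑ i, (∑ j, W i j * z j) ^ 2 ≤ ∑ i, ∑ j, W i j * z j ^ 2 := Finset.sum_le_sum fun i _ => h1 i
    _ = ∑ j, z j ^ 2 := by
      rw [Finset.sum_comm]
      refine Finset.sum_congr rfl fun j _ => ?_
      rw [← Finset.sum_mul, sum_col_of_mem_doublyStochastic hW, one_mul]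

lemma sum_sq_sub_mean_le (hn : 0 < n) (z : Fin n → ℝ) :
    ∑ j, (z j - 1 / (n : ℝ) * ∑ i, z i) ^ 2 ≤ ∑ j, z j ^ 2 := by
  have hn' : (n : ℝ) ≠ 0 := by positivity
  have : ∑ j, (z j - 1 / (n : ℝ) * ∑ i, z i) ^ 2
      = ∑ j, z j ^ 2 - 1 / (n : ℝ) * (∑ i, z i) ^ 2 := by
    simp only [sub_sq, Finset.sum_add_distrib, Finset.sum_sub_distrib, Finset.sum_const,
      Finset.card_univ, Fintype.card_fin, nsmul_eq_mul, ← Finset.sum_mul, ← Finset.mul_sum]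
    field_simp
    ring
  rw [this]
  have : 0 ≤ 1 / (n : ℝ) * (∑ i, z i) ^ 2 := by positivity
  linarith

lemma toEuclideanCLM_sub_avgMatrix_norm_le (hn : 0 < n) {W : Matrix (Fin n) (Fin n) ℝ}
    (hW : W ∈ doublyStochastic ℝ (Fin n)) (z : EuclideanSpace ℝ (Fin n)) :
    ‖Matrix.toEuclideanCLM (n := Fin n) (𝕜 := ℝ) (W - avgMatrix n) z‖ ≤ ‖z‖ := by
  refine le_of_sq_le_sq ?_ (norm_nonneg _)
  rw [EuclideanSpace.norm_sq_eq, EuclideanSpace.norm_sq_eq]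
  simp only [Real.norm_eq_abs, sq_abs, Matrix.ofLp_toEuclideanCLM]
  have : ∀ i, ((W - avgMatrix n).mulVec z.ofLp) i
      = ∑ j, W i j * (z j - 1 / (n : ℝ) * ∑ i, z i) := fun i => by
    simp only [Matrix.mulVec, dotProduct, Matrix.sub_apply, avgMatrix, Matrix.of_apply, sub_mul,
      mul_sub, Finset.sum_sub_distrib, ← Finset.mul_sum, ← Finset.sum_mul,
      sum_row_of_mem_doublyStochastic hW, one_mul]
  simp only [this]
  exact (sum_sq_mulVec_le hW _).trans (sum_sq_sub_mean_le hn _)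

lemma isPosContraction_toEuclideanCLM (hn : 0 < n) {W : Matrix (Fin n) (Fin n) ℝ}
    (hW : IsGossipMatrix W) {r : ℝ} (hr : 0 ≤ r)
    (h : ∀ z, ‖Matrix.toEuclideanCLM (n := Fin n) (𝕜 := ℝ) (W - avgMatrix n) z‖ ≤ r * ‖z‖) :
    IsPosContraction (Matrix.toEuclideanCLM (n := Fin n) (𝕜 := ℝ) (W - avgMatrix n)) r where
  symm x y := by
    have hH := (sub_avgMatrix_posSemidef hn hW).isHermitian
    rw [real_inner_comm, Matrix.inner_toEuclideanCLM, Matrix.inner_toEuclideanCLM,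
      Matrix.dotProduct_mulVec, ← Matrix.mulVec_transpose, dotProduct_comm]
    congr 2
  nonneg x := by
    rw [real_inner_comm, Matrix.inner_toEuclideanCLM]
    simpa using (sub_avgMatrix_posSemidef hn hW).dotProduct_mulVec_nonneg x.ofLp
  bound := h
  rate_nonneg := hr

/-- A vector fixed by an entrywise positive doubly stochastic matrix is constant. -/
lemma eq_of_mulVec_eq_self_of_pos {Q : Matrix (Fin n) (Fin n) ℝ}
    (hQ : Q ∈ doublyStochastic ℝ (Fin n)) (hpos : ∀ i j, 0 < Q i j) {z : Fin n → ℝ}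
    (hz : Q.mulVec z = z) (a b : Fin n) : z a = z b := by
  -- Maximum principle: at a maximal coordinate, z i is an average of all coordinates with positive
  -- weights, so all of them equal z i.
  obtain ⟨i, -, hi⟩ := Finset.exists_max_image Finset.univ z ⟨a, Finset.mem_univ _⟩
  have h0 : ∑ j, Q i j * (z i - z j) = 0 := by
    have := congrFun hz i
    simp only [Matrix.mulVec, dotProduct] at this
    simp only [mul_sub, Finset.sum_sub_distrib, ← Finset.sum_mul,
      sum_row_of_mem_doublyStochastic hQ, one_mul, this, sub_self]
  have h1 := (Finset.sum_eq_zero_iff_of_nonneg fun j _ =>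
    mul_nonneg (hpos i j).le (sub_nonneg.2 (hi j (Finset.mem_univ j)))).1 h0
  have h2 : ∀ j, z j = z i := fun j => by
    have := (mul_eq_zero.1 (h1 j (Finset.mem_univ j))).resolve_left (hpos i j).ne'
    linarith
  rw [h2 a, h2 b]

lemma eq_zero_of_mulVec_sub_avgMatrix_eq_self (hn : 0 < n) {W : Matrix (Fin n) (Fin n) ℝ}
    (hW : IsGossipMatrix W) {z : Fin n → ℝ} (hz : (W - avgMatrix n).mulVec z = z) : z = 0 := by
  -- J(W − J) = 0, so a fixed vector of W − J has zero mean and is also fixed by W and by its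
  -- powers.
  have hJ : (avgMatrix n).mulVec z = 0 := by
    rw [← hz, Matrix.mulVec_mulVec, mul_sub, avgMatrix_mul hW.doublyStochastic,
      avgMatrix_mul_self hn, sub_self, Matrix.zero_mulVec]
  have hWz : W.mulVec z = z := by
    rw [Matrix.sub_mulVec, hJ, sub_zero] at hz
    exact hz
  obtain ⟨k, -, hk⟩ := hW.primitive.exists_pos_pow
  have hpow : ∀ m : ℕ, (W ^ m).mulVec z = z := fun m => by
    induction m with
    | zero => simp
    | succ m ih => rw [pow_succ, ← Matrix.mulVec_mulVec, hWz, ih]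
  have hconst := eq_of_mulVec_eq_self_of_pos (pow_mem hW.doublyStochastic k) hk (hpow k)
  ext i
  have h := congrFun hJ i
  have hsum : ∑ j, z j = n * z i := by
    rw [Finset.sum_congr rfl fun j _ => hconst j i]
    simp
  simp only [avgMatrix, Matrix.mulVec, dotProduct, Matrix.of_apply, ← Finset.mul_sum, hsum,
    Pi.zero_apply] at h
  have hn' : (n : ℝ) ≠ 0 := by positivity
  field_simp at h
  exact h

/-- By compactness the norm is attained on the unit sphere. A unit vector with ‖T z‖ ≥ 1 would be
fixed by T, because T² ≤ T gives ‖T z − z‖² ≤ 1 − ‖T z‖²; primitivity excludes nonzero fixed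
vectors. -/
lemma mixingRate_lt_one (hn : 0 < n) {W : Matrix (Fin n) (Fin n) ℝ} (hW : IsGossipMatrix W) :
    mixingRate W < 1 := by
  have hT := isPosContraction_toEuclideanCLM hn hW zero_le_one fun z => by
    rw [one_mul]; exact toEuclideanCLM_sub_avgMatrix_norm_le hn hW.doublyStochastic z
  rw [mixingRate_eq]
  set T := Matrix.toEuclideanCLM (n := Fin n) (𝕜 := ℝ) (W - avgMatrix n) with hTdef
  have hstrict : ∀ z, ‖z‖ = 1 → ‖T z‖ < 1 := by
    intro z hz
    by_contra! hcon
    have h1 := hT.norm_sq_le_inner le_rfl z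
    have h2 := norm_sub_sq_real (T z) z
    have h3 : ‖T z - z‖ ^ 2 ≤ 0 := by
      rw [h2, hz]; nlinarith
    have h4 : T z = z := by
      have : ‖T z - z‖ = 0 := by nlinarith [norm_nonneg (T z - z)]
      exact sub_eq_zero.1 (norm_eq_zero.1 this)
    have h5 := eq_zero_of_mulVec_sub_avgMatrix_eq_self hn hW (z := z.ofLp) (by
      rw [← Matrix.ofLp_toEuclideanCLM, ← hTdef, h4])
    have h6 : z = 0 := WithLp.ofLp_injective 2 h5
    simp [h6] at hz
  have : Nonempty (Fin n) := ⟨⟨0, hn⟩⟩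
  have hne : (Metric.sphere (0 : EuclideanSpace ℝ (Fin n)) 1).Nonempty :=
    NormedSpace.sphere_nonempty.2 zero_le_one
  obtain ⟨u, hu, humax⟩ := (isCompact_sphere (0 : EuclideanSpace ℝ (Fin n)) 1).exists_isMaxOn hne
    (f := fun z => ‖T z‖) (by fun_prop)
  refine lt_of_le_of_lt (ContinuousLinearMap.opNorm_le_of_unit_norm (C := ‖T u‖) (norm_nonneg _)
    fun z hz => humax (by simpa using hz)) (hstrict u (by simpa using hu))

/-- The operator `(W - (1/n) 1 1ᵀ) ⊗ I`. -/
def mixOp (W : Matrix (Fin n) (Fin n) ℝ) : Stacked n d →L[ℝ] Stacked n d :=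
  blockOp (W - avgMatrix n)

lemma isPosContraction_mixOp (hn : 0 < n) {W : Matrix (Fin n) (Fin n) ℝ}
    (hW : IsGossipMatrix W) :
    IsPosContraction (mixOp W : Stacked n d →L[ℝ] Stacked n d) (mixingRate W) :=
  (isPosContraction_toEuclideanCLM hn hW (norm_nonneg _)
    fun z => ContinuousLinearMap.le_opNorm _ z).matrix_action

/-- The deviation of a stacked vector from its average. -/
def centerOp (n d : ℕ) : Stacked n d →L[ℝ] Stacked n d := blockOp (1 - avgMatrix n)

lemma blocks_centerOp (x : Stacked n d) (i : Fin n) :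
    (centerOp n d x).blocks i = x.blocks i - blockAvg x.blocks := by
  rw [centerOp, blockOp_sub, blockOp_one]
  simp [avgMatrix, blockAvg, Finset.smul_sum]

lemma norm_sq_centerOp (x : Stacked n d) : ‖centerOp n d x‖ ^ 2 = consensusErrorSq x.blocks := by
  rw [Stacked.norm_sq_eq]
  simp only [blocks_centerOp, consensusErrorSq]

/-- W and W − J differ by J, which W − J annihilates. Hence, behind one factor A, the whole dynamics
can be written in powers of A. -/
lemma mixOp_blockOp (hn : 0 < n) {W : Matrix (Fin n) (Fin n) ℝ}
    (hW : W ∈ doublyStochastic ℝ (Fin n)) (x : Stacked n d) :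
    mixOp W (blockOp W x) = mixOp W (mixOp W x) := by
  rw [mixOp, ← blockOp_mul, ← blockOp_mul]
  congr 2
  rw [mul_sub, sub_mul _ _ (avgMatrix n), mul_avgMatrix hW, avgMatrix_mul_self hn]
  abel

lemma mixOp_centerOp (hn : 0 < n) {W : Matrix (Fin n) (Fin n) ℝ}
    (hW : W ∈ doublyStochastic ℝ (Fin n)) (x : Stacked n d) :
    mixOp W (centerOp n d x) = mixOp W x := by
  rw [mixOp, centerOp, ← blockOp_mul]
  congr 2
  rw [mul_sub, mul_one, sub_mul, mul_avgMatrix hW, avgMatrix_mul_self hn]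
  abel

lemma centerOp_blockOp {W : Matrix (Fin n) (Fin n) ℝ}
    (hW : W ∈ doublyStochastic ℝ (Fin n)) (x : Stacked n d) :
    centerOp n d (blockOp W x) = mixOp W x := by
  rw [mixOp, centerOp, ← blockOp_mul, sub_mul, one_mul, avgMatrix_mul hW]

lemma blockAvg_blockOp {W : Matrix (Fin n) (Fin n) ℝ}
    (hW : W ∈ doublyStochastic ℝ (Fin n)) (x : Stacked n d) :
    blockAvg (blockOp W x).blocks = blockAvg x.blocks := by
  simp only [blockAvg, blocks_blockOp]
  rw [Finset.sum_comm]
  congr 1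
  refine Finset.sum_congr rfl fun j _ => ?_
  rw [← Finset.sum_smul, sum_col_of_mem_doublyStochastic hW, one_smul]

/-- Decomposition of the distance to a consensual vector into consensus error and mean error. -/
lemma sum_norm_sq_sub_eq (hn : 0 < n) (x : Fin n → RVec d) (y : RVec d) :
    ∑ i, ‖x i - y‖ ^ 2 = consensusErrorSq x + n * ‖blockAvg x - y‖ ^ 2 := by
  have h : ∀ i, ‖x i - y‖ ^ 2 = ‖x i - blockAvg x‖ ^ 2
      + 2 * inner ℝ (x i - blockAvg x) (blockAvg x - y) + ‖blockAvg x - y‖ ^ 2 := fun i => by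
    rw [← norm_add_sq_real]; congr 2; abel
  have h0 : ∑ i, (x i - blockAvg x) = 0 := by
    rw [Finset.sum_sub_distrib, Finset.sum_const, Finset.card_univ, Fintype.card_fin, blockAvg,
      ← Nat.cast_smul_eq_nsmul ℝ, smul_smul]
    have : (n : ℝ) ≠ 0 := by positivity
    rw [mul_one_div_cancel this, one_smul, sub_self]
  simp only [h, Finset.sum_add_distrib, ← Finset.mul_sum, ← sum_inner, h0, inner_zero_left,
    Finset.sum_const, Finset.card_univ, Fintype.card_fin, nsmul_eq_mul, consensusErrorSq]
  ring

/-- Jensen's inequality for the average of the blocks. -/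
lemma norm_sq_blockAvg_le (hn : 0 < n) (x : Fin n → RVec d) :
    ‖blockAvg x‖ ^ 2 ≤ 1 / (n : ℝ) * ∑ i, ‖x i‖ ^ 2 := by
  have h := sum_norm_sq_sub_eq hn x 0
  simp only [sub_zero] at h
  have h2 : 0 ≤ consensusErrorSq x := Finset.sum_nonneg fun _ _ => by positivity
  rw [h]
  have : (n : ℝ) ≠ 0 := by positivity
  have h3 : 0 ≤ 1 / (n : ℝ) * consensusErrorSq x := by positivity
  have h4 : 1 / (n : ℝ) * (n * ‖blockAvg x‖ ^ 2) = ‖blockAvg x‖ ^ 2 := by field_simp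
  linarith

end Gossip

/-! ### Strong convexity and one inexact gradient step -/

section Convex

variable {n d : ℕ}

namespace IsSmoothStronglyConvex

variable {L μ : ℝ} {f : RVec d → ℝ}

lemma hasDerivAt_line (hf : IsSmoothStronglyConvex L μ f) (x v : RVec d) :
    HasDerivAt (fun t : ℝ => f (x + t • v)) (inner ℝ (gradient f x) v) 0 := by
  have h1 : HasFDerivAt f (InnerProductSpace.toDual ℝ (RVec d) (gradient f x)) (x + (0 : ℝ) • v) := by
    rw [zero_smul, add_zero]
    exact (hf.differentiable x).hasGradientAt.hasFDerivAt
  have h2 : HasDerivAt (fun t : ℝ => x + t • v) v 0 := by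
    simpa using ((hasDerivAt_id (0 : ℝ)).smul_const v).const_add x
  have h3 := h1.comp_hasDerivAt 0 h2
  rw [InnerProductSpace.toDual_apply_apply] at h3
  exact h3

/-- The quadratic lower bound for strongly convex functions. -/
lemma add_inner_add_le (hf : IsSmoothStronglyConvex L μ f) (x y : RVec d) :
    f x + inner ℝ (gradient f x) (y - x) + μ / 2 * ‖y - x‖ ^ 2 ≤ f y := by
  -- The convexity inequality at x + t(y − x) is divided by t, and t tends to 0 from the right.
  have h1 := (hf.hasDerivAt_line x (y - x)).tendsto_slope_zero_right
  have h2 : Filter.Tendsto (fun t : ℝ => f y - f x - (1 - t) * (μ / 2 * ‖y - x‖ ^ 2))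
      (nhdsWithin 0 (Set.Ioi 0)) (nhds (f y - f x - (1 - 0) * (μ / 2 * ‖y - x‖ ^ 2))) :=
    (Continuous.tendsto (by fun_prop) 0).mono_left nhdsWithin_le_nhds
  have h3 := le_of_tendsto_of_tendsto h1 h2 (by
    filter_upwards [Ioo_mem_nhdsGT (zero_lt_one' ℝ)] with t ht
    have h4 := hf.strongConvex.2 (Set.mem_univ x) (Set.mem_univ y)
      (sub_nonneg.2 ht.2.le) ht.1.le (by ring)
    have h5 : (1 - t) • x + t • y = x + t • (y - x) := by
      rw [sub_smul, smul_sub, one_smul]; abel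
    rw [h5] at h4
    simp only [smul_eq_mul, zero_add, zero_smul, add_zero] at h4 ⊢
    rw [norm_sub_rev x y] at h4
    rw [inv_mul_le_iff₀ ht.1]
    linarith)
  linarith

lemma strong_monotone (hf : IsSmoothStronglyConvex L μ f) (x y : RVec d) :
    μ * ‖x - y‖ ^ 2 ≤ inner ℝ (gradient f x - gradient f y) (x - y) := by
  have h1 := hf.add_inner_add_le x y
  have h2 := hf.add_inner_add_le y x
  rw [norm_sub_rev y x, ← neg_sub x y, inner_neg_right] at h1
  rw [inner_sub_left]
  linarith

lemma continuous_gradient (hf : IsSmoothStronglyConvex L μ f) : Continuous (gradient f) := by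
  refine (LipschitzWith.of_dist_le_mul (K := L.toNNReal) fun x y => ?_).continuous
  rw [dist_eq_norm, dist_eq_norm]
  exact (hf.smooth x y).trans
    (mul_le_mul_of_nonneg_right (Real.le_coe_toNNReal L) (norm_nonneg _))

lemma smooth_sq (hf : IsSmoothStronglyConvex L μ f) (x y : RVec d) :
    ‖gradient f x - gradient f y‖ ^ 2 ≤ L ^ 2 * ‖x - y‖ ^ 2 := by
  rw [← mul_pow]
  exact pow_le_pow_left₀ (norm_nonneg _) (hf.smooth x y) 2

end IsSmoothStronglyConvex

/-- The gradients of the summands add up to zero at a minimizer of the average. -/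
lemma sum_gradient_eq_zero_of_isMinOn {L μ : ℝ} (hn : 0 < n) {f : Fin n → RVec d → ℝ}
    (hf : ∀ i, IsSmoothStronglyConvex L μ (f i)) {z : RVec d}
    (hz : IsMinOn (fun x => (1 / (n : ℝ)) * ∑ i, f i x) Set.univ z) :
    ∑ i, gradient (f i) z = 0 := by
  have h1 : HasFDerivAt (fun x => (1 / (n : ℝ)) * ∑ i, f i x)
      ((1 / (n : ℝ)) • ∑ i, InnerProductSpace.toDual ℝ (RVec d) (gradient (f i) z)) z :=
    (HasFDerivAt.fun_sum fun i _ =>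
      ((hf i).differentiable z).hasGradientAt.hasFDerivAt).const_mul _
  have h2 := (hz.isLocalMin Filter.univ_mem).hasFDerivAt_eq_zero h1
  have hn' : (1 / (n : ℝ)) ≠ 0 := by positivity
  rw [← map_sum] at h2
  exact (LinearIsometryEquiv.map_eq_zero_iff _).1 ((smul_eq_zero.1 h2).resolve_left hn')

/-- One inexact gradient step contracts the distance to the minimizer. -/
lemma norm_sq_sub_smul_le {E : Type*} [NormedAddCommGroup E] [InnerProductSpace ℝ E]
    {μ L α : ℝ} (hμ : 0 < μ) (hμL : μ ≤ L) (hα : 0 ≤ α) (hαL : 4 * L ^ 2 * α ≤ μ)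
    {a h r : E} (hmono : μ * ‖a‖ ^ 2 ≤ inner ℝ h a) (hsm : ‖h‖ ^ 2 ≤ L ^ 2 * ‖a‖ ^ 2) :
    ‖a - α • (h + r)‖ ^ 2 ≤ (1 - α * μ) * ‖a‖ ^ 2 + 4 / μ * α * ‖r‖ ^ 2 := by
  -- Of the decrease 2αμ‖a‖² given by monotonicity, Young's inequality on ⟨a, r⟩ consumes αμ/2 and
  -- the term 2α²‖h‖² another αμ/2, leaving αμ.
  have e1 : ‖a - α • (h + r)‖ ^ 2
      = ‖a‖ ^ 2 - 2 * α * inner ℝ h a - 2 * α * inner ℝ a r + α ^ 2 * ‖h + r‖ ^ 2 := by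
    rw [norm_sub_sq_real, inner_smul_right, inner_add_right, norm_smul, mul_pow,
      Real.norm_eq_abs, sq_abs, real_inner_comm h a]
    ring
  have e2 : ‖h + r‖ ^ 2 ≤ 2 * ‖h‖ ^ 2 + 2 * ‖r‖ ^ 2 := by
    have := parallelogram_law_with_norm ℝ h r
    nlinarith [sq_nonneg ‖h - r‖]
  have e3 : -(2 * inner ℝ a r) ≤ μ / 2 * ‖a‖ ^ 2 + 2 / μ * ‖r‖ ^ 2 := by
    have h1 := neg_le_of_abs_le (abs_real_inner_le_norm a r)
    have h2 : μ / 2 * ‖a‖ ^ 2 + 2 / μ * ‖r‖ ^ 2 - 2 * (‖a‖ * ‖r‖)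
        = (μ * ‖a‖ - 2 * ‖r‖) ^ 2 / (2 * μ) := by field_simp; ring
    have h3 : 0 ≤ (μ * ‖a‖ - 2 * ‖r‖) ^ 2 / (2 * μ) := by positivity
    linarith
  have e4 : α * (2 * α * L ^ 2) * ‖a‖ ^ 2 ≤ α * (μ / 2) * ‖a‖ ^ 2 := by
    gcongr; linarith
  have e5 : α * (2 * α) * ‖r‖ ^ 2 ≤ α * (2 / μ) * ‖r‖ ^ 2 := by
    have : α ≤ 1 / μ := by
      rw [le_div_iff₀ hμ]
      have h1 : μ ^ 2 ≤ L ^ 2 := pow_le_pow_left₀ hμ.le hμL 2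
      have h2 : 4 * μ ^ 2 * α ≤ μ := le_trans (by gcongr) hαL
      have h3 : μ * (4 * (α * μ)) ≤ μ * 1 := by linarith
      have := le_of_mul_le_mul_left h3 hμ
      nlinarith
    have h2 : 2 / μ = 2 * (1 / μ) := by ring
    rw [h2]; gcongr
  have e6 : α ^ 2 * ‖h + r‖ ^ 2 ≤ α ^ 2 * (2 * (L ^ 2 * ‖a‖ ^ 2) + 2 * ‖r‖ ^ 2) := by
    gcongr; linarith
  have e7 : α * (μ * ‖a‖ ^ 2) ≤ α * inner ℝ h a := by gcongr
  have e8 : α * -(2 * inner ℝ a r) ≤ α * (μ / 2 * ‖a‖ ^ 2 + 2 / μ * ‖r‖ ^ 2) := by gcongr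
  have e9 : 4 / μ * α * ‖r‖ ^ 2 = α * (2 / μ) * ‖r‖ ^ 2 + α * (2 / μ * ‖r‖ ^ 2) := by ring
  rw [e1, e9]
  linarith

lemma blockAvg_add (x y : Fin n → RVec d) :
    blockAvg (fun i => x i + y i) = blockAvg x + blockAvg y := by
  simp only [blockAvg, Finset.sum_add_distrib, smul_add]

lemma blockAvg_sub (x y : Fin n → RVec d) :
    blockAvg (fun i => x i - y i) = blockAvg x - blockAvg y := by
  simp only [blockAvg, Finset.sum_sub_distrib, smul_sub]

lemma blockAvg_const (hn : 0 < n) (y : RVec d) : blockAvg (fun _ : Fin n => y) = y := by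
  have : (n : ℝ) ≠ 0 := by positivity
  rw [blockAvg, Finset.sum_const, Finset.card_univ, Fintype.card_fin,
    ← Nat.cast_smul_eq_nsmul ℝ, smul_smul, one_div_mul_cancel this, one_smul]

/-- One step of the averaged iterates, without noise. -/
lemma mean_step_le {L μ α : ℝ} (hn : 0 < n) (hμ : 0 < μ) (hμL : μ ≤ L) (hα : 0 ≤ α)
    (hαL : 4 * L ^ 2 * α ≤ μ) {f : Fin n → RVec d → ℝ}
    (hf : ∀ i, IsSmoothStronglyConvex L μ (f i)) {z : RVec d}
    (hz : ∑ i, gradient (f i) z = 0) (x : Fin n → RVec d) :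
    ‖blockAvg x - α • blockAvg (fun i => gradient (f i) (x i)) - z‖ ^ 2
      ≤ (1 - α * μ) * ‖blockAvg x - z‖ ^ 2
        + 4 * L ^ 2 / μ * α * (1 / (n : ℝ) * consensusErrorSq x) := by
  have hn' : (n : ℝ) ≠ 0 := by positivity
  set b := blockAvg x with hb
  -- The averaged gradient splits into h, the gradient of the average cost at the mean point, and r,
  -- the error of evaluating local gradients away from the mean.
  set h : RVec d := blockAvg fun i => gradient (f i) b - gradient (f i) z with hh
  set r : RVec d := blockAvg fun i => gradient (f i) (x i) - gradient (f i) b with hr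
  have hz' : blockAvg (fun i => gradient (f i) z) = 0 := by rw [blockAvg, hz, smul_zero]
  have hsum : blockAvg (fun i => gradient (f i) (x i)) = h + r := by
    rw [hh, hr, blockAvg_sub, blockAvg_sub, hz']
    abel
  have hmono : μ * ‖b - z‖ ^ 2 ≤ inner ℝ h (b - z) := by
    rw [hh, blockAvg, real_inner_smul_left, sum_inner, div_mul_eq_mul_div, one_mul,
      le_div_iff₀ (by positivity)]
    calc μ * ‖b - z‖ ^ 2 * n = ∑ _i : Fin n, μ * ‖b - z‖ ^ 2 := by simp [mul_comm]
      _ ≤ _ := Finset.sum_le_sum fun i _ => (hf i).strong_monotone b z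
  have hsm : ‖h‖ ^ 2 ≤ L ^ 2 * ‖b - z‖ ^ 2 := by
    refine (norm_sq_blockAvg_le hn _).trans ?_
    calc 1 / (n : ℝ) * ∑ i, ‖gradient (f i) b - gradient (f i) z‖ ^ 2
        ≤ 1 / (n : ℝ) * ∑ _i : Fin n, L ^ 2 * ‖b - z‖ ^ 2 := by
          gcongr with i; exact (hf i).smooth_sq b z
      _ = _ := by simp; field_simp
  have hr2 : ‖r‖ ^ 2 ≤ L ^ 2 * (1 / (n : ℝ) * consensusErrorSq x) := by
    refine (norm_sq_blockAvg_le hn _).trans ?_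
    calc 1 / (n : ℝ) * ∑ i, ‖gradient (f i) (x i) - gradient (f i) b‖ ^ 2
        ≤ 1 / (n : ℝ) * ∑ i, L ^ 2 * ‖x i - b‖ ^ 2 := by
          gcongr with i; exact (hf i).smooth_sq _ _
      _ = _ := by rw [← Finset.mul_sum, consensusErrorSq]; ring
  have e : b - α • blockAvg (fun i => gradient (f i) (x i)) - z = (b - z) - α • (h + r) := by
    rw [hsum]; abel
  rw [e]
  refine (norm_sq_sub_smul_le hμ hμL hα hαL hmono hsm).trans ?_
  have : 4 / μ * α * ‖r‖ ^ 2 ≤ 4 / μ * α * (L ^ 2 * (1 / (n : ℝ) * consensusErrorSq x)) := by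
    gcongr
  calc _ ≤ (1 - α * μ) * ‖b - z‖ ^ 2 + 4 / μ * α * (L ^ 2 * (1 / (n : ℝ) * consensusErrorSq x)) := by
        linarith
    _ = _ := by ring

end Convex

/-! ### Orthogonality of noise under conditional independence -/

section Probability

variable {Ω : Type*} {m mΩ : MeasurableSpace Ω} {P : Measure Ω}

/-- The generating rectangles are stable under intersection, which is what an induction on π-systems
needs. -/
lemma sup_comap_eq_generateFrom {β : Type*} [mβ : MeasurableSpace β] (Y : Ω → β) :
    m ⊔ mβ.comap Y = MeasurableSpace.generateFrom
      {s | ∃ M B, MeasurableSet[m] M ∧ MeasurableSet B ∧ s = M ∩ Y ⁻¹' B} := by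
  refine le_antisymm (sup_le ?_ ?_) (MeasurableSpace.generateFrom_le ?_)
  · exact fun M hM => MeasurableSpace.measurableSet_generateFrom
      ⟨M, Set.univ, hM, MeasurableSet.univ, by simp⟩
  · rintro _ ⟨B, hB, rfl⟩
    exact MeasurableSpace.measurableSet_generateFrom
      ⟨Set.univ, B, @MeasurableSet.univ _ m, hB, by simp⟩
  · rintro _ ⟨M, B, hM, hB, rfl⟩
    exact MeasurableSet.inter (le_sup_left (b := mβ.comap Y) _ hM)
      (le_sup_right (a := m) _ ⟨B, hB, rfl⟩)

/-- A function whose integrals vanish over the sets `M ∩ Y⁻¹(B)` with `M ∈ m` has vanishing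
integrals over the σ-algebra that these sets generate. -/
lemma setIntegral_eq_zero_of_sup_comap {β : Type*} [mβ : MeasurableSpace β] {E : Type*}
    [NormedAddCommGroup E] [NormedSpace ℝ E] {Y : Ω → β} (hm : m ≤ mΩ) (hY : Measurable Y)
    {h : Ω → E} (hh : Integrable h P)
    (hbasic : ∀ M B, MeasurableSet[m] M → MeasurableSet B → ∫ ω in M ∩ Y ⁻¹' B, h ω ∂P = 0)
    {s : Set Ω} (hs : MeasurableSet[m ⊔ mβ.comap Y] s) : ∫ ω in s, h ω ∂P = 0 := by
  have hle : m ⊔ mβ.comap Y ≤ mΩ := sup_le hm hY.comap_le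
  have htot : ∫ ω, h ω ∂P = 0 := by
    simpa using hbasic Set.univ Set.univ MeasurableSet.univ MeasurableSet.univ
  refine MeasurableSpace.induction_on_inter (C := fun s _ => ∫ ω in s, h ω ∂P = 0)
    (sup_comap_eq_generateFrom Y) ?_ (by simp) ?_ ?_ ?_ s hs
  · rintro _ ⟨M, B, hM, hB, rfl⟩ _ ⟨M', B', hM', hB', rfl⟩ -
    exact ⟨M ∩ M', B ∩ B', @MeasurableSet.inter _ m _ _ hM hM', hB.inter hB', by
      rw [Set.preimage_inter]; exact Set.inter_inter_inter_comm _ _ _ _⟩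
  · rintro _ ⟨M, B, hM, hB, rfl⟩
    exact hbasic M B hM hB
  · intro t ht hzero
    have := integral_add_compl (hle t ht) hh
    rw [hzero, htot, zero_add] at this
    exact this
  · intro g hdisj hg hzero
    rw [integral_iUnion (fun i => hle _ (hg i)) hdisj hh.integrableOn]
    simp [hzero]

variable {E : Type*} [NormedAddCommGroup E] [InnerProductSpace ℝ E]

lemma integrable_inner_of_memLp {a v : Ω → E} (ha : MemLp a 2 P) (hv : MemLp v 2 P) :
    Integrable (fun ω => (inner ℝ (a ω) (v ω) : ℝ)) P := by
  have := (innerSL ℝ (E := E)).memLp_of_bilin 1 ha hv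
  exact memLp_one_iff_integrable.1 this

variable [CompleteSpace E]

/-- Centered noise is orthogonal to the past. -/
lemma integral_inner_eq_zero_of_condExp_eq_zero [IsFiniteMeasure P] (hm : m ≤ mΩ) {a v : Ω → E}
    (ham : StronglyMeasurable[m] a) (ha : MemLp a 2 P) (hv : MemLp v 2 P)
    (hv0 : P[v | m] =ᵐ[P] 0) : ∫ ω, inner ℝ (a ω) (v ω) ∂P = 0 := by
  have h := condExp_bilin_of_stronglyMeasurable_left (innerSL ℝ (E := E)) (m := m) (μ := P) ham
    (integrable_inner_of_memLp ha hv) (hv.integrable one_le_two)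
  rw [← integral_condExp hm (f := fun ω => (inner ℝ (a ω) (v ω) : ℝ))]
  refine integral_eq_zero_of_ae (h.trans ?_)
  filter_upwards [hv0] with ω hω
  simp [hω]

variable {β γ : Type*} [mβ : MeasurableSpace β] [mγ : MeasurableSpace γ] {X : Ω → β} {Y : Ω → γ}

/-- Under conditional independence given `m`, conditioning an event of `X` on `m` and `Y` is the
same as conditioning it on `m`. -/
lemma condExp_sup_comap_of_condIndep [IsProbabilityMeasure P] (hm : m ≤ mΩ) (hX : Measurable X)
    (hY : Measurable Y)
    (hind : ∀ A B, MeasurableSet A → MeasurableSet B →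
      P[(X ⁻¹' A ∩ Y ⁻¹' B).indicator (fun _ => (1 : ℝ)) | m]
        =ᵐ[P] P[(X ⁻¹' A).indicator (fun _ => (1 : ℝ)) | m]
          * P[(Y ⁻¹' B).indicator (fun _ => (1 : ℝ)) | m])
    {A : Set β} (hA : MeasurableSet A) :
    P[(X ⁻¹' A).indicator (fun _ => (1 : ℝ)) | m ⊔ mγ.comap Y]
      =ᵐ[P] P[(X ⁻¹' A).indicator (fun _ => (1 : ℝ)) | m] := by
  have hle : m ⊔ mγ.comap Y ≤ mΩ := sup_le hm hY.comap_le
  set q := P[(X ⁻¹' A).indicator (fun _ => (1 : ℝ)) | m] with hq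
  have hind1 : ∀ s, MeasurableSet s → Integrable (s.indicator (fun _ => (1 : ℝ))) P :=
    fun s hs => (integrable_const 1).indicator hs
  have hqb : ∀ᵐ ω ∂P, ‖q ω‖ ≤ 1 :=
    ae_bdd_abs_condExp_of_ae_bdd_abs (R := (1 : ℝ)) (Filter.Eventually.of_forall fun ω => by
      by_cases h : ω ∈ X ⁻¹' A <;> simp [h])
  have hqi : Integrable q P := integrable_condExp
  have hqm : StronglyMeasurable[m] q := stronglyMeasurable_condExp
  have hqm2 : StronglyMeasurable[m ⊔ mγ.comap Y] q := hqm.mono le_sup_left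
  refine (ae_eq_condExp_of_forall_setIntegral_eq hle (hind1 _ (hX hA))
    (fun _ _ _ => hqi.integrableOn) (fun s hs _ => ?_)
    hqm2.aestronglyMeasurable).symm
  rw [← sub_eq_zero, ← integral_sub hqi.integrableOn (hind1 _ (hX hA)).integrableOn]
  -- It suffices to test on M ∩ Y⁻¹(B). There the indicator of Y⁻¹(B) is averaged given m, and the
  -- product formula for conditional probabilities applies.
  refine setIntegral_eq_zero_of_sup_comap hm hY (hqi.sub (hind1 _ (hX hA))) (fun M B hM hB => ?_) hs
  have hYB := hY hB
  have hqB : Integrable (fun ω => q ω * (Y ⁻¹' B).indicator (fun _ => (1 : ℝ)) ω) P :=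
    (hind1 _ hYB).bdd_mul hqi.aestronglyMeasurable hqb
  rw [integral_sub' hqi.integrableOn (hind1 _ (hX hA)).integrableOn, sub_eq_zero]
  have e1 : ∫ ω in M ∩ Y ⁻¹' B, q ω ∂P
      = ∫ ω in M, q ω * (Y ⁻¹' B).indicator (fun _ => (1 : ℝ)) ω ∂P := by
    rw [← setIntegral_indicator hYB]
    congr 1; ext ω
    by_cases h : ω ∈ Y ⁻¹' B <;> simp [h]
  have e2 : ∫ ω in M ∩ Y ⁻¹' B, (X ⁻¹' A).indicator (fun _ => (1 : ℝ)) ω ∂P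
      = ∫ ω in M, (X ⁻¹' A ∩ Y ⁻¹' B).indicator (fun _ => (1 : ℝ)) ω ∂P := by
    rw [← setIntegral_indicator hYB]
    congr 1; ext ω
    rw [Set.indicator_indicator, Set.inter_comm]
  rw [e1, e2, ← setIntegral_condExp hm hqB hM, ← setIntegral_condExp hm (hind1 _ ((hX hA).inter hYB)) hM]
  refine integral_congr_ae (ae_restrict_of_ae ?_)
  exact (condExp_mul_of_aestronglyMeasurable_left hqm.aestronglyMeasurable hqB
    (hind1 _ hYB)).trans (hind A B hA hB).symm

/-- Under conditional independence given `m`, noise that depends on `m` and `Y` only and is centered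
given `m` is centered given `m` and `X`. -/
lemma condExp_sup_comap_eq_zero_of_condIndep [IsProbabilityMeasure P] (hm : m ≤ mΩ)
    (hX : Measurable X) (hY : Measurable Y)
    (hind : ∀ A B, MeasurableSet A → MeasurableSet B →
      P[(X ⁻¹' A ∩ Y ⁻¹' B).indicator (fun _ => (1 : ℝ)) | m]
        =ᵐ[P] P[(X ⁻¹' A).indicator (fun _ => (1 : ℝ)) | m]
          * P[(Y ⁻¹' B).indicator (fun _ => (1 : ℝ)) | m])
    {w : Ω → E} (hwm : StronglyMeasurable[m ⊔ mγ.comap Y] w) (hw : Integrable w P)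
    (hw0 : P[w | m] =ᵐ[P] 0) :
    P[w | m ⊔ mβ.comap X] =ᵐ[P] 0 := by
  have hle : m ⊔ mγ.comap Y ≤ mΩ := sup_le hm hY.comap_le
  have hle' : m ⊔ mβ.comap X ≤ mΩ := sup_le hm hX.comap_le
  refine (ae_eq_condExp_of_forall_setIntegral_eq (g := fun _ => (0 : E)) hle' hw
    (fun _ _ _ => integrableOn_zero) (fun s hs _ => ?_)
    aestronglyMeasurable_const).symm
  rw [integral_zero]
  refine (setIntegral_eq_zero_of_sup_comap hm hX hw (fun M A hM hA => ?_) hs).symm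
  have hXA := hX hA
  set i : Ω → ℝ := (X ⁻¹' A).indicator (fun _ => (1 : ℝ)) with hi
  have hii : Integrable i P := (integrable_const 1).indicator hXA
  have hib : ∀ᵐ ω ∂P, |i ω| ≤ 1 := Filter.Eventually.of_forall fun ω => by
    by_cases h : ω ∈ X ⁻¹' A <;> simp [hi, h]
  have hMw : Integrable (M.indicator w) P := hw.indicator (hm _ hM)
  have hMwm : StronglyMeasurable[m ⊔ mγ.comap Y] (M.indicator w) :=
    hwm.indicator (le_sup_left (b := mγ.comap Y) _ hM)
  set q := P[i | m] with hq
  have hqb : ∀ᵐ ω ∂P, ‖q ω‖ ≤ 1 := ae_bdd_abs_condExp_of_ae_bdd_abs (R := (1 : ℝ)) hib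
  have hiMw : Integrable (i • M.indicator w) P :=
    hMw.bdd_smul 1 hii.aestronglyMeasurable hib
  have hqMw : Integrable (q • M.indicator w) P :=
    hMw.bdd_smul 1 integrable_condExp.aestronglyMeasurable hqb
  have e1 : ∫ ω in M ∩ X ⁻¹' A, w ω ∂P = ∫ ω, (i • M.indicator w) ω ∂P := by
    rw [← integral_indicator ((hm _ hM).inter hXA)]
    congr 1; ext ω
    by_cases h : ω ∈ X ⁻¹' A <;> by_cases h' : ω ∈ M <;> simp [hi, h, h']
  rw [e1, ← integral_condExp hle]
  -- Given m and Y the vector w is known, and the indicator of X⁻¹(A) may be replaced by its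
  -- conditional probability q given m alone. As q is m-measurable, centering of w given m then
  -- finishes.
  have e2 : P[i • M.indicator w | m ⊔ mγ.comap Y] =ᵐ[P] q • M.indicator w := by
    refine (condExp_smul_of_aestronglyMeasurable_right hii hiMw hMwm.aestronglyMeasurable).trans ?_
    filter_upwards [condExp_sup_comap_of_condIndep hm hX hY hind hA] with ω hω
    simp only [Pi.smul_apply', hq, hi, hω]
  rw [integral_congr_ae e2, ← integral_condExp hm]
  refine integral_eq_zero_of_ae ?_
  refine (condExp_smul_of_aestronglyMeasurable_left
    stronglyMeasurable_condExp.aestronglyMeasurable hqMw hMw).trans ?_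
  filter_upwards [condExp_indicator hw hM, hw0] with ω h1 h2
  simp [h1, h2]

/-- Centered noises driven by conditionally independent data are uncorrelated. -/
lemma integral_inner_eq_zero_of_condIndep [IsProbabilityMeasure P] (hm : m ≤ mΩ)
    (hX : Measurable X) (hY : Measurable Y)
    (hind : ∀ A B, MeasurableSet A → MeasurableSet B →
      P[(X ⁻¹' A ∩ Y ⁻¹' B).indicator (fun _ => (1 : ℝ)) | m]
        =ᵐ[P] P[(X ⁻¹' A).indicator (fun _ => (1 : ℝ)) | m]
          * P[(Y ⁻¹' B).indicator (fun _ => (1 : ℝ)) | m])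
    {u w : Ω → E} (hum : StronglyMeasurable[m ⊔ mβ.comap X] u)
    (hwm : StronglyMeasurable[m ⊔ mγ.comap Y] w) (hu : MemLp u 2 P) (hw : MemLp w 2 P)
    (hw0 : P[w | m] =ᵐ[P] 0) : ∫ ω, inner ℝ (u ω) (w ω) ∂P = 0 :=
  -- Adjoining X to m makes u part of the past, and w stays centered.
  integral_inner_eq_zero_of_condExp_eq_zero (sup_le hm hX.comap_le) hum hu hw
    (condExp_sup_comap_eq_zero_of_condIndep hm hX hY hind hwm (hw.integrable one_le_two) hw0)

end Probability

/-! ### Coupled scalar recursions and the choice of stepsize -/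

section Recursion

/-- Two coupled scalar recursions preserve simultaneous bounds of the form `A ρ^k + B`. -/
lemma coupled_recursion_le {e v : ℕ → ℝ} {a₁ a₂ a₃ b₁ b₂ b₃ A A' B B' ρ : ℝ}
    (ha₁ : 0 ≤ a₁) (ha₂ : 0 ≤ a₂) (hb₁ : 0 ≤ b₁) (hb₂ : 0 ≤ b₂) (hρ : 0 ≤ ρ)
    (he : ∀ k, 1 ≤ k → e (k + 1) ≤ a₁ * e k + a₂ * v k + a₃)
    (hv : ∀ k, 1 ≤ k → v (k + 1) ≤ b₁ * v k + b₂ * e k + b₃)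
    (heA : a₁ * A + a₂ * A' ≤ ρ * A) (heB : a₁ * B + a₂ * B' + a₃ ≤ B)
    (hvA : b₁ * A' + b₂ * A ≤ ρ * A') (hvB : b₁ * B' + b₂ * B + b₃ ≤ B')
    (he₁ : e 1 ≤ A * ρ + B) (hv₁ : v 1 ≤ A' * ρ + B') {k : ℕ} (hk : 1 ≤ k) :
    e k ≤ A * ρ ^ k + B ∧ v k ≤ A' * ρ ^ k + B' := by
  induction k, hk using Nat.le_induction with
  | base => simpa using ⟨he₁, hv₁⟩
  | succ k hk ih =>
    obtain ⟨ih₁, ih₂⟩ := ih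
    have hρk : 0 ≤ ρ ^ k := pow_nonneg hρ k
    have p1 := mul_le_mul_of_nonneg_right heA hρk
    have p2 := mul_le_mul_of_nonneg_right hvA hρk
    have q1 := mul_le_mul_of_nonneg_left ih₁ ha₁
    have q2 := mul_le_mul_of_nonneg_left ih₂ ha₂
    have q3 := mul_le_mul_of_nonneg_left ih₂ hb₁
    have q4 := mul_le_mul_of_nonneg_left ih₁ hb₂
    have h1 := he k hk
    have h2 := hv k hk
    constructor <;> rw [pow_succ] <;> linarith

variable {L μ : ℝ}

/-- The largest stepsize used, up to the factor `1 - λ`. -/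
def maxStep (L μ : ℝ) : ℝ := μ / (64 * L ^ 2)

/-- The constant in the bound for a fixed stepsize. -/
def rateConst (L μ : ℝ) : ℝ :=
  (1 + μ ^ 2 / (8 * L ^ 2)) * (1 + 1 / L ^ 2) + 5 / (4 * μ) + μ / (16 * L ^ 2)
    + 192 * L ^ 2 / μ ^ 2 + 48

lemma maxStep_pos (hμ : 0 < μ) (hμL : μ ≤ L) : 0 < maxStep L μ := by
  have : 0 < L := by linarith
  unfold maxStep; positivity

lemma rateConst_pos (hμ : 0 < μ) (hμL : μ ≤ L) : 0 < rateConst L μ := by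
  have : 0 < L := by linarith
  unfold rateConst; positivity

lemma mul_maxStep (hμ : 0 < μ) (hμL : μ ≤ L) : L ^ 2 * maxStep L μ = μ / 64 := by
  have : 0 < L := by linarith
  unfold maxStep; field_simp

lemma mu_mul_maxStep_le (hμ : 0 < μ) (hμL : μ ≤ L) : μ * maxStep L μ ≤ 1 / 64 := by
  have hL : 0 < L := by linarith
  have : μ ^ 2 ≤ L ^ 2 := pow_le_pow_left₀ hμ.le hμL 2
  unfold maxStep
  rw [mul_div_assoc', div_le_div_iff₀ (by positivity) (by norm_num)]
  nlinarith

set_option maxHeartbeats 400000 in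
/-- The recursions of the mean error `e` and the consensus error `v` imply the convergence rate
for a fixed stepsize `α`. -/
lemma tracking_rate (hμ : 0 < μ) (hμL : μ ≤ L) {α δ N s a ς : ℝ} (hα : 0 < α) (hδ : 0 < δ)
    (hδ1 : δ ≤ 1) (hαδ : α ≤ maxStep L μ * δ) (hN : 0 < N) (hs : 0 ≤ s) (ha : 0 ≤ a) (hς : 0 ≤ ς)
    {e v : ℕ → ℝ}
    (he : ∀ k, 1 ≤ k → e (k + 1) ≤ (1 - α * μ) * e k + 4 * L ^ 2 / μ * α * v k + α ^ 2 * (s / N))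
    (hv : ∀ k, 1 ≤ k →
      v (k + 1) ≤ (1 - δ / 8) * v k + 15 * L ^ 2 * (α ^ 2 / δ) * e k + 3 * α ^ 2 * s)
    (he₁ : e 1 ≤ (1 - α * μ) * a + α ^ 2 * (s / N))
    (hv₁ : v 1 ≤ 2 * α ^ 2 * s + 4 * α ^ 2 * (L ^ 2 * a + ς) + 2 * maxStep L μ ^ 2 * ς)
    {k : ℕ} (hk : 1 ≤ k) :
    e k + v k ≤ rateConst L μ * ((a + ς) * (1 - α * μ / 2) ^ k + α * (s / N) + α ^ 2 * (s / δ)) := by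
  have hL : 0 < L := by linarith
  have hc := maxStep_pos hμ hμL
  set c := maxStep L μ with hcdef
  have hcμ : μ * c ≤ 1 / 64 := mu_mul_maxStep_le hμ hμL
  have hc_eq : c = μ / (64 * L ^ 2) := rfl
  have hαc : α ≤ c := hαδ.trans (mul_le_of_le_one_right hc.le hδ1)
  have hαμδ : α * μ ≤ δ / 64 := by
    have h1 := mul_le_mul_of_nonneg_right hαδ hμ.le
    have h2 := mul_le_mul_of_nonneg_right hcμ hδ.le
    linarith
  have hαμ : α * μ ≤ 1 / 64 := by linarith
  have hα2 : α ^ 2 / δ ≤ c ^ 2 * δ := by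
    rw [div_le_iff₀ hδ]
    calc α ^ 2 ≤ (c * δ) ^ 2 := pow_le_pow_left₀ hα.le hαδ 2
      _ = _ := by ring
  have hLα : L ^ 2 * (α ^ 2 / δ) ≤ μ ^ 2 / (4096 * L ^ 2) * δ := by
    calc L ^ 2 * (α ^ 2 / δ) ≤ L ^ 2 * (c ^ 2 * δ) := by gcongr
      _ = μ ^ 2 / (4096 * L ^ 2) * δ := by rw [hc_eq]; field_simp; norm_num
  -- κ is the ratio of the transients of v and e for which the coupling 4L²α/μ · κ equals αμ/2, half
  -- of the decay of e.
  obtain ⟨κ, hκ⟩ : ∃ t, t = μ ^ 2 / (8 * L ^ 2) := ⟨_, rfl⟩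
  have hκ0 : 0 < κ := by rw [hκ]; positivity
  have hLα' : L ^ 2 * (α ^ 2 / δ) ≤ κ * δ / 512 := by
    refine hLα.trans (le_of_eq ?_)
    rw [hκ]; field_simp; norm_num
  -- The factor 1 + 1/L² converts ς, a squared gradient, to the scale of a squared distance.
  obtain ⟨A, hA⟩ : ∃ t, t = (1 + 1 / L ^ 2) * (a + ς) := ⟨_, rfl⟩
  have hA0 : 0 ≤ A := by rw [hA]; positivity
  obtain ⟨p, hp⟩ : ∃ t, t = α * (s / N) := ⟨_, rfl⟩
  obtain ⟨q, hq⟩ : ∃ t, t = α ^ 2 * (s / δ) := ⟨_, rfl⟩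
  have hp0 : 0 ≤ p := by rw [hp]; positivity
  have hq0 : 0 ≤ q := by rw [hq]; positivity
  -- B and B' are the noise floors. B is the exact equilibrium of the e-recursion given B'. In B',
  -- the decay δ/8 turns 48q into 6q, enough for the noise 3q and the feedback of B; the multiple of
  -- p absorbs the rest of that feedback.
  obtain ⟨B', hB'⟩ : ∃ t, t = μ / (16 * L ^ 2) * p + 48 * q := ⟨_, rfl⟩
  obtain ⟨B, hB⟩ : ∃ t, t = 5 / (4 * μ) * p + 192 * L ^ 2 / μ ^ 2 * q := ⟨_, rfl⟩
  have hsq : α ^ 2 * s = δ * q := by rw [hq]; field_simp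
  have hBeq : μ * B = 4 * L ^ 2 / μ * B' + p := by
    rw [hB, hB']; field_simp; ring
  have hB0 : 0 ≤ B := by rw [hB]; positivity
  have hB0' : 0 ≤ B' := by rw [hB']; positivity
  have key := coupled_recursion_le (e := e) (v := v) (a₁ := 1 - α * μ) (a₂ := 4 * L ^ 2 / μ * α)
    (a₃ := α ^ 2 * (s / N)) (b₁ := 1 - δ / 8) (b₂ := 15 * L ^ 2 * (α ^ 2 / δ)) (b₃ := 3 * α ^ 2 * s)
    (A := A) (A' := κ * A) (B := B) (B' := B') (ρ := 1 - α * μ / 2)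
    (by linarith) (by positivity) (by linarith) (by positivity) (by linarith) he hv
    (by
      have : 4 * L ^ 2 / μ * α * (κ * A) = α * μ / 2 * A := by rw [hκ]; field_simp; ring
      rw [this]; linarith)
    (by
      have : α ^ 2 * (s / N) = α * p := by rw [hp]; ring
      have h2 : α * (μ * B) = α * (4 * L ^ 2 / μ * B' + p) := by rw [hBeq]
      rw [this]; linarith)
    (by
      have h1 : 15 * L ^ 2 * (α ^ 2 / δ) * A ≤ 15 * (κ * δ / 512) * A := by
        have := mul_le_mul_of_nonneg_right hLα' hA0
        linarith
      have h2 : 0 ≤ κ * A := by positivity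
      have h3 := mul_nonneg h2 hδ.le
      have h4 := mul_le_mul_of_nonneg_right hαμδ h2
      linarith)
    (by
      have h1 : 15 * L ^ 2 * (α ^ 2 / δ) * B ≤ 15 * (μ ^ 2 / (4096 * L ^ 2) * δ) * B := by
        have := mul_le_mul_of_nonneg_right hLα hB0
        linarith
      have h2 : 15 * (μ ^ 2 / (4096 * L ^ 2) * δ) * B
          = δ * (75 / 16384 * (μ / L ^ 2 * p) + 2880 / 4096 * q) := by
        rw [hB]; field_simp; ring
      have h3 : (1 - δ / 8) * B' = B' - δ * (1 / 128 * (μ / L ^ 2 * p) + 6 * q) := by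
        rw [hB']; field_simp; ring
      have h4 : 3 * α ^ 2 * s = δ * (3 * q) := by linarith
      have h5 : 0 ≤ μ / L ^ 2 * p := by positivity
      have h6 : δ * (75 / 16384 * (μ / L ^ 2 * p) + 2880 / 4096 * q) + δ * (3 * q)
          ≤ δ * (1 / 128 * (μ / L ^ 2 * p) + 6 * q) := by
        rw [← mul_add]
        exact mul_le_mul_of_nonneg_left (by linarith) hδ.le
      rw [h3, h4]
      linarith)
    (by
      refine he₁.trans ?_
      have h1 : (1 - α * μ) * a ≤ A * (1 - α * μ / 2) := by
        have : a ≤ A := by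
          have : 0 ≤ 1 / L ^ 2 * (a + ς) := by positivity
          rw [hA]; linarith
        have h4 : (1 - α * μ) * a ≤ (1 - α * μ) * A :=
          mul_le_mul_of_nonneg_left this (by linarith)
        have h5 : 0 ≤ α * μ * A := by positivity
        linarith
      have h2 : α ^ 2 * (s / N) ≤ 5 / (4 * μ) * p := by
        have h3 : α ^ 2 * (s / N) = α * p := by rw [hp]; ring
        rw [h3]
        refine mul_le_mul_of_nonneg_right ?_ hp0
        rw [le_div_iff₀ (by linarith)]
        linarith
      have h3 : 0 ≤ 192 * L ^ 2 / μ ^ 2 * q := by positivity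
      rw [hB]; linarith)
    (by
      refine hv₁.trans ?_
      have hα2c : α ^ 2 ≤ c ^ 2 := pow_le_pow_left₀ hα.le hαc 2
      have h1 : 4 * α ^ 2 * (L ^ 2 * a + ς) + 2 * c ^ 2 * ς ≤ 4 * c ^ 2 * (L ^ 2 * a + ς) + 2 * c ^ 2 * ς := by
        gcongr
      have h2 : 4 * c ^ 2 * (L ^ 2 * a + ς) + 2 * c ^ 2 * ς
          = κ * (1 / 128 * a + 3 / 256 * (1 / L ^ 2 * ς)) := by
        rw [hc_eq, hκ]; field_simp; ring
      have h3 : 1 / 128 * a + 3 / 256 * (1 / L ^ 2 * ς) ≤ 1 / 2 * A := by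
        have e1 : 0 ≤ 1 / L ^ 2 * a := by positivity
        have e2 : 0 ≤ 1 / L ^ 2 * ς := by positivity
        have e3 : A = a + ς + 1 / L ^ 2 * a + 1 / L ^ 2 * ς := by rw [hA]; ring
        rw [e3]; linarith
      have h4 : κ * (1 / 2 * A) ≤ κ * A * (1 - α * μ / 2) := by
        have h5 : 0 ≤ κ * A := by positivity
        have h6 := mul_le_mul_of_nonneg_left hαμ h5
        linarith
      have h5 := mul_le_mul_of_nonneg_left h3 hκ0.le
      have h6 : 2 * α ^ 2 * s ≤ 48 * q := by
        have := mul_le_of_le_one_left hq0 hδ1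
        linarith
      have h7 : 0 ≤ μ / (16 * L ^ 2) * p := by positivity
      rw [hB']; linarith) hk
  obtain ⟨R, hR⟩ : ∃ t, t = (1 - α * μ / 2) ^ k := ⟨_, rfl⟩
  have hρk : 0 ≤ R := hR ▸ pow_nonneg (by linarith) k
  rw [← hR] at key ⊢
  have hsum : e k + v k ≤ (1 + κ) * A * R + (B + B') := by
    have := key.1; have := key.2; linarith
  refine hsum.trans ?_
  obtain ⟨M, hM⟩ : ∃ t, t = (a + ς) * R := ⟨_, rfl⟩
  rw [← hM]
  have hM0 : 0 ≤ M := by rw [hM]; positivity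
  have e1 : (1 + κ) * A * R = (1 + κ) * (1 + 1 / L ^ 2) * M := by rw [hA, hM]; ring
  have hr : rateConst L μ = (1 + κ) * (1 + 1 / L ^ 2) + 5 / (4 * μ) + μ / (16 * L ^ 2)
    + 192 * L ^ 2 / μ ^ 2 + 48 := by rw [hκ]; rfl
  have t1 : (1 + κ) * (1 + 1 / L ^ 2) ≤ rateConst L μ := by
    have : 0 ≤ 5 / (4 * μ) + μ / (16 * L ^ 2) + 192 * L ^ 2 / μ ^ 2 := by positivity
    rw [hr]; linarith
  have t2 : 5 / (4 * μ) + μ / (16 * L ^ 2) ≤ rateConst L μ := by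
    have : 0 ≤ (1 + κ) * (1 + 1 / L ^ 2) + 192 * L ^ 2 / μ ^ 2 := by positivity
    rw [hr]; linarith
  have t3 : 192 * L ^ 2 / μ ^ 2 + 48 ≤ rateConst L μ := by
    have : 0 ≤ (1 + κ) * (1 + 1 / L ^ 2) + 5 / (4 * μ) + μ / (16 * L ^ 2) := by positivity
    rw [hr]; linarith
  have u1 := mul_le_mul_of_nonneg_right t1 hM0
  have u2 := mul_le_mul_of_nonneg_right t2 hp0
  have u3 := mul_le_mul_of_nonneg_right t3 hq0
  rw [e1, hB, hB', ← hp, ← hq]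
  linarith

/-- The constant lost by tuning the stepsize. -/
def tuneConst (μ : ℝ) : ℝ := 1 / Real.log 2 + 2 / μ + 4 / μ ^ 2 + 1

lemma tuneConst_pos (hμ : 0 < μ) : 0 < tuneConst μ := by
  have : 0 < Real.log 2 := Real.log_pos one_lt_two
  unfold tuneConst; positivity

/-- Choice of the stepsize. -/
lemma exists_stepsize (hμ : 0 < μ) (hμL : μ ≤ L) {n K : ℕ} (hn : 0 < n) (hK : 1 ≤ K)
    {δ σ a ς : ℝ} (hδ : 0 < δ) (hδ1 : δ ≤ 1) (hσ : 0 ≤ σ) (ha : 0 ≤ a) (hς : 0 ≤ ς) :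
    ∃ α > (0 : ℝ), α ≤ maxStep L μ * δ ∧
      (a + ς) * (1 - α * μ / 2) ^ K + α * (σ ^ 2 / n) + α ^ 2 * (σ ^ 2 / δ)
        ≤ tuneConst μ * (gtLogFactor n K σ a ς * (σ ^ 2 / (n * K))
          + gtLogFactor n K σ a ς ^ 2 * (σ ^ 2 / (δ * K ^ 2))
          + gtLogFactor n K σ a ς ^ 3 * (σ ^ 2 / (δ ^ 2 * n * K ^ 3))
          + (a + ς) * Real.exp (-(maxStep L μ * μ / 2 * δ * K))) := by
  have hc := maxStep_pos hμ hμL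
  have hcμ := mu_mul_maxStep_le hμ hμL
  set c := maxStep L μ with hcdef
  have hnR : (0 : ℝ) < n := by exact_mod_cast hn
  have hKR : (0 : ℝ) < K := by exact_mod_cast hK
  have hlog2 : 0 < Real.log 2 := Real.log_pos one_lt_two
  set ℓ := gtLogFactor n K σ a ς with hℓ
  have hℓ2 : Real.log 2 ≤ ℓ := by
    refine Real.log_le_log two_pos ?_
    have : 0 ≤ n * K * (a + ς) / σ ^ 2 := by positivity
    linarith
  have hℓ0 : 0 < ℓ := hlog2.trans_le hℓ2
  set M := a + ς with hM
  have hM0 : 0 ≤ M := by positivity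
  set T₁ := ℓ * (σ ^ 2 / (n * K)) with hT₁
  set T₂ := ℓ ^ 2 * (σ ^ 2 / (δ * K ^ 2)) with hT₂
  set T₃ := ℓ ^ 3 * (σ ^ 2 / (δ ^ 2 * n * K ^ 3)) with hT₃
  set T₄ := M * Real.exp (-(c * μ / 2 * δ * K)) with hT₄
  have hT₁0 : 0 ≤ T₁ := by positivity
  have hT₂0 : 0 ≤ T₂ := by positivity
  have hT₃0 : 0 ≤ T₃ := by positivity
  have hT₄0 : 0 ≤ T₄ := by positivity
  have hpow : ∀ α : ℝ, α ≤ c * δ → (1 - α * μ / 2) ^ K ≤ Real.exp (-(α * μ / 2 * K)) := by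
    intro α hα
    have h1 : α * μ ≤ 1 := by nlinarith [mul_le_of_le_one_right hc.le hδ1]
    calc (1 - α * μ / 2) ^ K ≤ Real.exp (-(α * μ / 2)) ^ K :=
          pow_le_pow_left₀ (by linarith) (Real.one_sub_le_exp_neg _) K
      _ = _ := by rw [← Real.exp_nat_mul]; congr 1; ring
  have hbig : (a + ς) * (1 - c * δ * μ / 2) ^ K ≤ T₄ := by
    rw [hT₄, ← hM]
    refine mul_le_mul_of_nonneg_left ((hpow (c * δ) le_rfl).trans (le_of_eq ?_)) hM0
    congr 2; ring
  have f1 : 0 < 1 / Real.log 2 := by positivity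
  have f2 : 0 < 2 / μ := by positivity
  have f3 : 0 < 4 / μ ^ 2 := by positivity
  -- Only T₁, T₂ and T₄ are used; T₃ enters as a nonnegative surplus.
  have hfinal : ∀ x : ℝ, x ≤ (1 / Real.log 2) * T₁ + T₄ + 2 / μ * T₁ + 4 / μ ^ 2 * T₂ →
      x ≤ tuneConst μ * (T₁ + T₂ + T₃ + T₄) := by
    intro x hx
    refine hx.trans ?_
    unfold tuneConst
    have g1 : 0 ≤ 1 / Real.log 2 * (T₂ + T₃ + T₄) := by positivity
    have g2 : 0 ≤ 2 / μ * (T₂ + T₃ + T₄) := by positivity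
    have g3 : 0 ≤ 4 / μ ^ 2 * (T₁ + T₃ + T₄) := by positivity
    linarith
  rcases eq_or_lt_of_le hσ with hσ0 | hσ0
  · refine ⟨c * δ, by positivity, le_rfl, hfinal _ ?_⟩
    have z1 : 0 ≤ 1 / Real.log 2 * T₁ + 2 / μ * T₁ + 4 / μ ^ 2 * T₂ := by positivity
    have z2 : c * δ * (σ ^ 2 / n) + (c * δ) ^ 2 * (σ ^ 2 / δ) = 0 := by rw [← hσ0]; simp
    linarith
  · have hτ : 0 < 2 * ℓ / (μ * K) := by positivity
    -- The second candidate solves αμK/2 = ℓ, so that the transient factor is at most exp(−ℓ); the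
    -- first is the stability limit.
    refine ⟨min (c * δ) (2 * ℓ / (μ * K)), lt_min (by positivity) hτ, min_le_left _ _,
      hfinal _ ?_⟩
    set α := min (c * δ) (2 * ℓ / (μ * K)) with hα
    have hα0 : 0 < α := lt_min (by positivity) hτ
    have hατ : α ≤ 2 * ℓ / (μ * K) := min_le_right _ _
    have b1 : α * (σ ^ 2 / n) ≤ 2 / μ * T₁ := by
      calc α * (σ ^ 2 / n) ≤ 2 * ℓ / (μ * K) * (σ ^ 2 / n) := by gcongr
        _ = 2 / μ * T₁ := by rw [hT₁]; field_simp
    have b2 : α ^ 2 * (σ ^ 2 / δ) ≤ 4 / μ ^ 2 * T₂ := by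
      calc α ^ 2 * (σ ^ 2 / δ) ≤ (2 * ℓ / (μ * K)) ^ 2 * (σ ^ 2 / δ) := by gcongr
        _ = 4 / μ ^ 2 * T₂ := by rw [hT₂]; field_simp; ring
    have b3 : M * (1 - α * μ / 2) ^ K ≤ 1 / Real.log 2 * T₁ + T₄ := by
      rcases min_choice (c * δ) (2 * ℓ / (μ * K)) with h | h
      · rw [hα, h]
        have : 0 ≤ 1 / Real.log 2 * T₁ := by positivity
        linarith
      · have h1 := hpow α (min_le_left _ _)
        have h2 : α * μ / 2 * K = ℓ := by rw [hα, h]; field_simp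
        -- The argument of the logarithm is designed for this: M exp(−ℓ) falls below the noise level
        -- σ²/(nK).
        have h3 : Real.exp (-ℓ) = (2 + n * K * M / σ ^ 2)⁻¹ := by
          rw [Real.exp_neg, hℓ, gtLogFactor, Real.exp_log (by positivity)]
        rw [h2, h3] at h1
        have h4 : M * (2 + n * K * M / σ ^ 2)⁻¹ ≤ σ ^ 2 / (n * K) := by
          rw [← div_eq_mul_inv, div_le_iff₀ (by positivity)]
          have : σ ^ 2 / (n * K) * (2 + n * K * M / σ ^ 2) = 2 * (σ ^ 2 / (n * K)) + M := by
            field_simp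
          rw [this]
          have : 0 ≤ σ ^ 2 / (n * K) := by positivity
          linarith
        have h5 : σ ^ 2 / (n * K) ≤ 1 / Real.log 2 * T₁ := by
          rw [hT₁, ← mul_assoc]
          refine le_mul_of_one_le_left (by positivity) ?_
          rw [one_div_mul_eq_div, one_le_div hlog2]
          exact hℓ2
        have h6 := mul_le_mul_of_nonneg_left h1 hM0
        linarith
    linarith

end Recursion

/-! ### Pathwise identities and measurability for gradient tracking -/

section Tracking

variable {n d : ℕ}

/-- The stacked local gradients. -/
def stackGrad (f : Fin n → RVec d → ℝ) (x : Stacked n d) : Stacked n d :=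
  Stacked.mk fun i => gradient (f i) (x.blocks i)

/-- The average of the blocks, as a continuous linear map. -/
def avgOp (n d : ℕ) : Stacked n d →L[ℝ] RVec d :=
  ⟨{ toFun := fun x => blockAvg x.blocks
     map_add' := fun x y => blockAvg_add x.blocks y.blocks
     map_smul' := fun c x => by
       simp only [blockAvg, Stacked.blocks_smul, Pi.smul_apply, ← Finset.smul_sum,
         RingHom.id_apply]
       rw [smul_comm] }, LinearMap.continuous_of_finiteDimensional _⟩

lemma avgOp_apply (x : Stacked n d) : avgOp n d x = blockAvg x.blocks := rfl

lemma memLp_of_sub {Ω E : Type*} [MeasurableSpace Ω] {P : Measure Ω} [NormedAddCommGroup E]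
    {u w : Ω → E} (huw : MemLp (fun ω => u ω - w ω) 2 P) (hw : MemLp w 2 P) : MemLp u 2 P := by
  have : u = (fun ω => u ω - w ω) + w := by ext1 ω; simp
  rw [this]
  exact huw.add hw

section StackGrad

variable {L μ : ℝ} {f : Fin n → RVec d → ℝ}

lemma continuous_stackGrad (hf : ∀ i, IsSmoothStronglyConvex L μ (f i)) :
    Continuous (stackGrad f) :=
  Stacked.continuous_mk.comp (continuous_pi fun i =>
    (hf i).continuous_gradient.comp ((continuous_apply i).comp Stacked.continuous_blocks))

lemma norm_sq_stackGrad_sub_le (hf : ∀ i, IsSmoothStronglyConvex L μ (f i)) (x y : Stacked n d) :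
    ‖stackGrad f x - stackGrad f y‖ ^ 2 ≤ L ^ 2 * ‖x - y‖ ^ 2 := by
  rw [Stacked.norm_sq_eq, Stacked.norm_sq_eq, Finset.mul_sum]
  exact Finset.sum_le_sum fun i _ => (hf i).smooth_sq _ _

lemma memLp_stackGrad {Ω : Type*} [MeasurableSpace Ω] {P : Measure Ω} [IsFiniteMeasure P]
    (hf : ∀ i, IsSmoothStronglyConvex L μ (f i)) {X : Ω → Stacked n d} (hX : MemLp X 2 P) :
    MemLp (fun ω => stackGrad f (X ω)) 2 P := by
  have h1 : MemLp (fun ω => stackGrad f (X ω) - stackGrad f 0) 2 P := by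
    refine hX.of_le_mul (c := |L|) (((continuous_stackGrad hf).comp_aestronglyMeasurable
      hX.aestronglyMeasurable).sub aestronglyMeasurable_const) (Filter.Eventually.of_forall
      fun ω => ?_)
    refine le_of_sq_le_sq ?_ (by positivity)
    rw [mul_pow, sq_abs]
    simpa using norm_sq_stackGrad_sub_le hf (X ω) 0
  exact memLp_of_sub h1 (memLp_const _)

end StackGrad

lemma integral_norm_sq_add_of_orthogonal {Ω E : Type*} [MeasurableSpace Ω] {P : Measure Ω}
    [NormedAddCommGroup E] [InnerProductSpace ℝ E] {a b : Ω → E} (ha : MemLp a 2 P)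
    (hb : MemLp b 2 P) (h : ∫ ω, inner ℝ (a ω) (b ω) ∂P = 0) :
    ∫ ω, ‖a ω + b ω‖ ^ 2 ∂P = ∫ ω, ‖a ω‖ ^ 2 ∂P + ∫ ω, ‖b ω‖ ^ 2 ∂P := by
  have ha2 := ha.integrable_norm_pow two_ne_zero
  have hb2 := hb.integrable_norm_pow two_ne_zero
  have hab := (integrable_inner_of_memLp ha hb).const_mul 2
  simp only [norm_add_sq_real]
  rw [integral_add (f := fun ω => ‖a ω‖ ^ 2 + 2 * inner ℝ (a ω) (b ω)) (ha2.add hab) hb2,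
    integral_add ha2 hab, integral_const_mul, h]
  ring

/-- Gradient tracking driven by stochastic gradients `G k`, whose noise is centered given `m k`,
with total variance `n σ²` and variance `σ² / n` on average over the agents. -/
structure IsNoisyTracking {Ω : Type*} [mΩ : MeasurableSpace Ω] (P : Measure Ω)
    (m : ℕ → MeasurableSpace Ω) (f : Fin n → RVec d → ℝ) (W : Matrix (Fin n) (Fin n) ℝ)
    (α σ : ℝ) (x0 : RVec d) (X Y G : ℕ → Ω → Stacked n d) : Prop where
  X_zero : ∀ ω, X 0 ω = Stacked.mk fun _ => x0
  Y_zero : ∀ ω, Y 0 ω = G 0 ω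
  X_succ : ∀ k ω, X (k + 1) ω = blockOp W (X k ω - α • Y k ω)
  Y_succ : ∀ k ω, Y (k + 1) ω = blockOp W (Y k ω + G (k + 1) ω - G k ω)
  mono : Monotone m
  le : ∀ k, m k ≤ mΩ
  meas_X : ∀ k, StronglyMeasurable[m k] (X k)
  memLp_noise : ∀ k, MemLp (fun ω => G k ω - stackGrad f (X k ω)) 2 P
  -- The form in which conditional centering is used: zero correlation with every square-integrable
  -- vector known at time k.
  orthogonal : ∀ k (a : Ω → Stacked n d), StronglyMeasurable[m k] a → MemLp a 2 P →
    ∫ ω, inner ℝ (a ω) (G k ω - stackGrad f (X k ω)) ∂P = 0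
  variance : ∀ k, ∫ ω, ‖G k ω - stackGrad f (X k ω)‖ ^ 2 ∂P ≤ n * σ ^ 2
  variance_avg : ∀ k, ∫ ω, ‖avgOp n d (G k ω - stackGrad f (X k ω))‖ ^ 2 ∂P ≤ σ ^ 2 / n

/-- The gradients accumulated through the mixing operator `A`, from iteration one on. -/
def mixedSum {E : Type*} [AddCommGroup E] (A : E → E) (G : ℕ → E) : ℕ → E
  | 0 => 0
  | k + 1 => A (mixedSum A G k) + A (A (G (k + 1)))

namespace IsNoisyTracking

variable {Ω : Type*} [mΩ : MeasurableSpace Ω] {P : Measure Ω}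
  {m : ℕ → MeasurableSpace Ω} {f : Fin n → RVec d → ℝ} {W : Matrix (Fin n) (Fin n) ℝ}
  {α σ L μ : ℝ} {x0 : RVec d} {X Y G : ℕ → Ω → Stacked n d}

/-- The tracking invariant: averaging is unaffected by W, and the gradient increments telescope. -/
lemma avg_Y (h : IsNoisyTracking P m f W α σ x0 X Y G) (hW : W ∈ doublyStochastic ℝ (Fin n))
    (k : ℕ) (ω : Ω) : avgOp n d (Y k ω) = avgOp n d (G k ω) := by
  induction k with
  | zero => rw [h.Y_zero]
  | succ k ih =>
    rw [h.Y_succ, avgOp_apply, blockAvg_blockOp hW, ← avgOp_apply, map_sub, map_add, ih]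
    abel

lemma avg_X_succ (h : IsNoisyTracking P m f W α σ x0 X Y G)
    (hW : W ∈ doublyStochastic ℝ (Fin n)) (k : ℕ) (ω : Ω) :
    avgOp n d (X (k + 1) ω) = avgOp n d (X k ω) - α • avgOp n d (G k ω) := by
  rw [h.X_succ, avgOp_apply, blockAvg_blockOp hW, ← avgOp_apply, map_sub, map_smul, h.avg_Y hW]

/-- Summation by parts in the tracker recursion. The sum starts at iteration one because Y 0 = G 0
cancels the initial gradient in the first update. -/
lemma mix_Y_succ (h : IsNoisyTracking P m f W α σ x0 X Y G) (hn : 0 < n)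
    (hW : W ∈ doublyStochastic ℝ (Fin n)) (k : ℕ) (ω : Ω) :
    mixOp W (Y (k + 1) ω) = mixOp W (mixOp W (G (k + 1) ω))
      - (mixedSum (mixOp W) (fun t => G t ω) k
        - mixOp W (mixedSum (mixOp W) (fun t => G t ω) k)) := by
  induction k with
  | zero =>
    rw [h.Y_succ, h.Y_zero, mixOp_blockOp hn hW, mixedSum, map_zero]
    simp
  | succ k ih =>
    rw [h.Y_succ, mixOp_blockOp hn hW, map_sub, map_add, ih, mixedSum]
    simp only [map_sub, map_add]
    abel

lemma center_X_succ (h : IsNoisyTracking P m f W α σ x0 X Y G) (hn : 0 < n)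
    (hW : W ∈ doublyStochastic ℝ (Fin n)) (k : ℕ) (ω : Ω) :
    centerOp n d (X (k + 1) ω) = mixOp W (centerOp n d (X k ω)) - α • mixOp W (Y k ω) := by
  rw [h.X_succ, centerOp_blockOp hW, map_sub, map_smul, mixOp_centerOp hn hW]

lemma center_X_succ_succ (h : IsNoisyTracking P m f W α σ x0 X Y G) (hn : 0 < n)
    (hW : W ∈ doublyStochastic ℝ (Fin n)) (k : ℕ) (ω : Ω) :
    centerOp n d (X (k + 2) ω) = mixOp W (centerOp n d (X (k + 1) ω))
      + α • (mixedSum (mixOp W) (fun t => G t ω) k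
        - mixOp W (mixedSum (mixOp W) (fun t => G t ω) k))
      - α • mixOp W (mixOp W (G (k + 1) ω)) := by
  rw [h.center_X_succ hn hW, h.mix_Y_succ hn hW, smul_sub]
  abel

/-- The accumulated gradients are known to the history of the iterates. -/
lemma meas_mixedSum (h : IsNoisyTracking P m f W α σ x0 X Y G) (hn : 0 < n)
    (hW : W ∈ doublyStochastic ℝ (Fin n)) (hα : α ≠ 0) (k : ℕ) :
    StronglyMeasurable[m (k + 1)] (fun ω => mixedSum (mixOp W) (fun t => G t ω) k) := by
  induction k with
  | zero => exact stronglyMeasurable_const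
  | succ k ih =>
    have ih' := ih.mono (h.mono (Nat.le_succ (k + 1)))
    have hA : ∀ {g : Ω → Stacked n d}, StronglyMeasurable[m (k + 2)] g →
        StronglyMeasurable[m (k + 2)] (fun ω => mixOp W (g ω)) :=
      fun hg => (mixOp W).continuous.comp_stronglyMeasurable hg
    have hX2 : StronglyMeasurable[m (k + 2)] (fun ω => centerOp n d (X (k + 2) ω)) :=
      (centerOp n d).continuous.comp_stronglyMeasurable (h.meas_X (k + 2))
    have hX1 : StronglyMeasurable[m (k + 2)] (fun ω => centerOp n d (X (k + 1) ω)) :=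
      (centerOp n d).continuous.comp_stronglyMeasurable
        ((h.meas_X (k + 1)).mono (h.mono (Nat.le_succ (k + 1))))
    -- The gradients themselves need not be measurable for the history of the iterates, but A² G can
    -- be solved for from two consecutive centered iterates and the previous sum. This requires α ≠
    -- 0.
    have hG : (fun ω => mixOp W (mixOp W (G (k + 1) ω))) = fun ω => α⁻¹ •
        (mixOp W (centerOp n d (X (k + 1) ω))
          + α • (mixedSum (mixOp W) (fun t => G t ω) k
            - mixOp W (mixedSum (mixOp W) (fun t => G t ω) k))
          - centerOp n d (X (k + 2) ω)) := by
      ext1 ω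
      rw [h.center_X_succ_succ hn hW, sub_sub_cancel, smul_smul, inv_mul_cancel₀ hα, one_smul]
    have hGm : StronglyMeasurable[m (k + 2)] (fun ω => mixOp W (mixOp W (G (k + 1) ω))) := by
      rw [hG]
      exact (((hA hX1).add ((ih'.sub (hA ih')).const_smul α)).sub hX2).const_smul α⁻¹
    exact (hA ih').add hGm

variable [IsProbabilityMeasure P]

lemma memLp_XY (h : IsNoisyTracking P m f W α σ x0 X Y G)
    (hf : ∀ i, IsSmoothStronglyConvex L μ (f i)) (k : ℕ) :
    MemLp (X k) 2 P ∧ MemLp (Y k) 2 P := by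
  have hG : ∀ k, MemLp (X k) 2 P → MemLp (G k) 2 P := fun k hX => by
    exact memLp_of_sub (h.memLp_noise k) (memLp_stackGrad hf hX)
  induction k with
  | zero =>
    have hX : MemLp (X 0) 2 P := by rw [funext h.X_zero]; exact memLp_const _
    exact ⟨hX, by rw [funext h.Y_zero]; exact hG 0 hX⟩
  | succ k ih =>
    have hX : MemLp (X (k + 1)) 2 P := by
      rw [funext (h.X_succ k)]
      exact (blockOp W).comp_memLp' (ih.1.sub (ih.2.const_smul α))
    refine ⟨hX, ?_⟩
    rw [funext (h.Y_succ k)]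
    exact (blockOp W).comp_memLp' ((ih.2.add (hG _ hX)).sub (hG _ ih.1))

lemma memLp_X (h : IsNoisyTracking P m f W α σ x0 X Y G)
    (hf : ∀ i, IsSmoothStronglyConvex L μ (f i)) (k : ℕ) : MemLp (X k) 2 P := (h.memLp_XY hf k).1

lemma memLp_G (h : IsNoisyTracking P m f W α σ x0 X Y G)
    (hf : ∀ i, IsSmoothStronglyConvex L μ (f i)) (k : ℕ) : MemLp (G k) 2 P := by
  exact memLp_of_sub (h.memLp_noise k) (memLp_stackGrad hf (h.memLp_X hf k))

lemma memLp_mixedSum (h : IsNoisyTracking P m f W α σ x0 X Y G)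
    (hf : ∀ i, IsSmoothStronglyConvex L μ (f i)) (k : ℕ) :
    MemLp (fun ω => mixedSum (mixOp W) (fun t => G t ω) k) 2 P := by
  induction k with
  | zero => exact memLp_const 0
  | succ k ih =>
    exact ((mixOp W).comp_memLp' ih).add
      ((mixOp W).comp_memLp' ((mixOp W).comp_memLp' (h.memLp_G hf (k + 1))))

end IsNoisyTracking

end Tracking

/-! ### Mean-square recursions and the rate for a fixed stepsize -/

lemma centerOp_const {n d : ℕ} (hn : 0 < n) (y : RVec d) :
    centerOp n d (Stacked.mk fun _ => y) = 0 := by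
  ext1 i
  rw [blocks_centerOp, Stacked.blocks_mk, blockAvg_const hn, sub_self]
  rfl

namespace IsNoisyTracking

variable {n d : ℕ} {Ω : Type*} [mΩ : MeasurableSpace Ω] {P : Measure Ω} [IsProbabilityMeasure P]
  {m : ℕ → MeasurableSpace Ω} {f : Fin n → RVec d → ℝ} {W : Matrix (Fin n) (Fin n) ℝ}
  {α σ L μ : ℝ} {x0 z : RVec d} {X Y G : ℕ → Ω → Stacked n d}

/-- The recursion of the mean error. -/
lemma mean_recursion (h : IsNoisyTracking P m f W α σ x0 X Y G) (hn : 0 < n)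
    (hW : W ∈ doublyStochastic ℝ (Fin n)) (hμ : 0 < μ) (hμL : μ ≤ L) (hα : 0 ≤ α)
    (hαL : 4 * L ^ 2 * α ≤ μ) (hf : ∀ i, IsSmoothStronglyConvex L μ (f i))
    (hz : ∑ i, gradient (f i) z = 0) (k : ℕ) :
    ∫ ω, ‖avgOp n d (X (k + 1) ω) - z‖ ^ 2 ∂P
      ≤ (1 - α * μ) * ∫ ω, ‖avgOp n d (X k ω) - z‖ ^ 2 ∂P
        + 4 * L ^ 2 / μ * α * (1 / (n : ℝ) * ∫ ω, ‖centerOp n d (X k ω)‖ ^ 2 ∂P)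
        + α ^ 2 * (σ ^ 2 / n) := by
  have hX := h.memLp_X hf k
  set v : Ω → Stacked n d := fun ω => G k ω - stackGrad f (X k ω) with hv
  have hv2 : MemLp v 2 P := h.memLp_noise k
  set a : Ω → RVec d := fun ω =>
    avgOp n d (X k ω) - α • avgOp n d (stackGrad f (X k ω)) - z with ha
  have hgrad : StronglyMeasurable[m k] (fun ω => stackGrad f (X k ω)) :=
    (continuous_stackGrad hf).comp_stronglyMeasurable (h.meas_X k)
  have ham : StronglyMeasurable[m k] a :=
    ((((avgOp n d).continuous.comp_stronglyMeasurable (h.meas_X k)).sub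
      (((avgOp n d).continuous.comp_stronglyMeasurable hgrad).const_smul α)).sub
        stronglyMeasurable_const)
  have ha2 : MemLp a 2 P := (((avgOp n d).comp_memLp' hX).sub
    (((avgOp n d).comp_memLp' (memLp_stackGrad hf hX)).const_smul α)).sub (memLp_const z)
  have hb2 : MemLp (fun ω => -(α • avgOp n d (v ω))) 2 P :=
    (((avgOp n d).comp_memLp' hv2).const_smul α).neg
  have hnR : (0 : ℝ) < n := by exact_mod_cast hn
  have horth : ∫ ω, inner ℝ (a ω) (-(α • avgOp n d (v ω))) ∂P = 0 := by
    have hcont : Continuous (fun y : RVec d => (Stacked.mk fun _ : Fin n => y)) :=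
      Stacked.continuous_mk.comp (continuous_pi fun _ => continuous_id)
    -- The adjoint of averaging is 1/n times copying a vector to all agents, which reduces the claim
    -- to orthogonality of the stacked noise.
    have hdual : ∀ (y : RVec d) (w : Stacked n d),
        inner ℝ y (avgOp n d w) = 1 / (n : ℝ) * inner ℝ (Stacked.mk fun _ => y) w := by
      intro y w
      rw [avgOp_apply, blockAvg, real_inner_smul_right, inner_sum, Stacked.inner_eq]
      rfl
    have h0 := h.orthogonal k (fun ω => Stacked.mk fun _ => a ω)
      (hcont.comp_stronglyMeasurable ham) (by
        refine ha2.of_le_mul (c := Real.sqrt n)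
          (hcont.comp_aestronglyMeasurable ha2.aestronglyMeasurable)
          (Filter.Eventually.of_forall fun ω => ?_)
        refine le_of_sq_le_sq ?_ (by positivity)
        rw [mul_pow, Real.sq_sqrt hnR.le, Stacked.norm_sq_eq]
        simp)
    simp only [inner_neg_right, real_inner_smul_right, hdual]
    rw [integral_neg, integral_const_mul, integral_const_mul, h0]
    simp
  have hsplit : ∀ ω, avgOp n d (X (k + 1) ω) - z = a ω + -(α • avgOp n d (v ω)) := by
    intro ω
    rw [h.avg_X_succ hW]
    simp only [ha, hv, map_sub]
    module
  have hvar : ∫ ω, ‖-(α • avgOp n d (v ω))‖ ^ 2 ∂P ≤ α ^ 2 * (σ ^ 2 / n) := by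
    simp only [norm_neg, norm_smul, mul_pow, Real.norm_eq_abs, sq_abs]
    rw [integral_const_mul]
    exact mul_le_mul_of_nonneg_left (h.variance_avg k) (sq_nonneg α)
  have hdet : ∫ ω, ‖a ω‖ ^ 2 ∂P ≤ (1 - α * μ) * ∫ ω, ‖avgOp n d (X k ω) - z‖ ^ 2 ∂P
        + 4 * L ^ 2 / μ * α * (1 / (n : ℝ) * ∫ ω, ‖centerOp n d (X k ω)‖ ^ 2 ∂P) := by
    have i1 : Integrable (fun ω => ‖avgOp n d (X k ω) - z‖ ^ 2) P :=
      (((avgOp n d).comp_memLp' hX).sub (memLp_const z)).integrable_norm_pow two_ne_zero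
    have i2 : Integrable (fun ω => ‖centerOp n d (X k ω)‖ ^ 2) P :=
      ((centerOp n d).comp_memLp' hX).integrable_norm_pow two_ne_zero
    rw [← integral_const_mul, ← integral_const_mul, ← integral_const_mul,
      ← integral_add (i1.const_mul _) ((i2.const_mul _).const_mul _)]
    refine integral_mono (ha2.integrable_norm_pow two_ne_zero)
      ((i1.const_mul _).add ((i2.const_mul _).const_mul _)) fun ω => ?_
    rw [norm_sq_centerOp]
    exact mean_step_le hn hμ hμL hα hαL hf hz (X k ω).blocks
  simp only [hsplit]
  rw [integral_norm_sq_add_of_orthogonal ha2 hb2 horth]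
  linarith

/-- The recursion of the consensus Lyapunov function. -/
lemma consensus_recursion (h : IsNoisyTracking P m f W α σ x0 X Y G) (hn : 0 < n)
    (hW : IsGossipMatrix W) (hμ : 0 < μ) (hμL : μ ≤ L) (hα : 0 < α)
    (hαδ : α ≤ maxStep L μ * (1 - mixingRate W)) (hf : ∀ i, IsSmoothStronglyConvex L μ (f i))
    {s : Stacked n d}
    (hs : s - mixOp W s = mixOp W (mixOp W (stackGrad f (Stacked.mk fun _ => z)))) (k : ℕ) :
    ∫ ω, ‖centerOp n d (X (k + 2) ω)‖ ^ 2 ∂P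
        + 2 * ∫ ω, ‖α • (mixedSum (mixOp W) (fun t => G t ω) (k + 1) - s)‖ ^ 2 ∂P
      ≤ (1 - (1 - mixingRate W) / 8) * (∫ ω, ‖centerOp n d (X (k + 1) ω)‖ ^ 2 ∂P
        + 2 * ∫ ω, ‖α • (mixedSum (mixOp W) (fun t => G t ω) k - s)‖ ^ 2 ∂P)
        + n * (15 * L ^ 2 * (α ^ 2 / (1 - mixingRate W))
          * ∫ ω, ‖avgOp n d (X (k + 1) ω) - z‖ ^ 2 ∂P) + n * (3 * α ^ 2 * σ ^ 2) := by
  have hA := isPosContraction_mixOp (d := d) hn hW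
  have hlt := mixingRate_lt_one hn hW
  set A : Stacked n d →L[ℝ] Stacked n d := mixOp W with hAdef
  set r := mixingRate W with hr
  have hδ : 0 < 1 - r := by linarith
  have hL : 0 < L := by linarith
  have hX := h.memLp_X hf (k + 1)
  set gz : Stacked n d := stackGrad f (Stacked.mk fun _ => z) with hgz
  set S : ℕ → Ω → Stacked n d := fun k ω => α • (mixedSum A (fun t => G t ω) k - s) with hS
  set x : Ω → Stacked n d := fun ω => centerOp n d (X (k + 1) ω) with hx
  set D : Ω → Stacked n d := fun ω => α • (stackGrad f (X (k + 1) ω) - gz) with hD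
  set v : Ω → Stacked n d := fun ω => G (k + 1) ω - stackGrad f (X (k + 1) ω) with hv
  -- p and t are the parts of the next state known at time k + 1. The fresh noise q enters the two
  -- components with opposite signs.
  set p : Ω → Stacked n d := fun ω => A (x ω) + (S k ω - A (S k ω)) - A (A (D ω)) with hp
  set t : Ω → Stacked n d := fun ω => A (S k ω) + A (A (D ω)) with ht
  set q : Ω → Stacked n d := fun ω => α • A (A (v ω)) with hq
  have hSm : StronglyMeasurable[m (k + 1)] (S k) :=
    ((h.meas_mixedSum hn hW.doublyStochastic hα.ne' k).sub stronglyMeasurable_const).const_smul α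
  have hxm : StronglyMeasurable[m (k + 1)] x :=
    (centerOp n d).continuous.comp_stronglyMeasurable (h.meas_X (k + 1))
  have hDm : StronglyMeasurable[m (k + 1)] D :=
    (((continuous_stackGrad hf).comp_stronglyMeasurable (h.meas_X (k + 1))).sub
      stronglyMeasurable_const).const_smul α
  have hAm : ∀ {g : Ω → Stacked n d}, StronglyMeasurable[m (k + 1)] g →
      StronglyMeasurable[m (k + 1)] (fun ω => A (g ω)) :=
    fun hg => A.continuous.comp_stronglyMeasurable hg
  have hpm : StronglyMeasurable[m (k + 1)] p :=
    ((hAm hxm).add (hSm.sub (hAm hSm))).sub (hAm (hAm hDm))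
  have htm : StronglyMeasurable[m (k + 1)] t := (hAm hSm).add (hAm (hAm hDm))
  have hS2 : MemLp (S k) 2 P := ((h.memLp_mixedSum hf k).sub (memLp_const s)).const_smul α
  have hx2 : MemLp x 2 P := (centerOp n d).comp_memLp' hX
  have hD2 : MemLp D 2 P := ((memLp_stackGrad hf hX).sub (memLp_const gz)).const_smul α
  have hA2 : ∀ {g : Ω → Stacked n d}, MemLp g 2 P → MemLp (fun ω => A (g ω)) 2 P :=
    fun hg => A.comp_memLp' hg
  have hp2 : MemLp p 2 P := ((hA2 hx2).add (hS2.sub (hA2 hS2))).sub (hA2 (hA2 hD2))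
  have ht2 : MemLp t 2 P := (hA2 hS2).add (hA2 (hA2 hD2))
  have hq2 : MemLp q 2 P := (hA2 (hA2 (h.memLp_noise (k + 1)))).const_smul α
  have horth : ∀ {g : Ω → Stacked n d}, StronglyMeasurable[m (k + 1)] g → MemLp g 2 P →
      ∫ ω, inner ℝ (g ω) (q ω) ∂P = 0 := by
    intro g hgm hg2
    have h0 := h.orthogonal (k + 1) (fun ω => A (A (g ω))) (hAm (hAm hgm)) (hA2 (hA2 hg2))
    -- Symmetry moves both factors A from the noise onto the known vector.
    have h1 : ∀ ω, inner ℝ (g ω) (q ω) = α * inner ℝ (A (A (g ω))) (v ω) := fun ω => by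
      rw [hq, real_inner_smul_right, hA.symm, hA.symm]
    simp only [h1]
    rw [integral_const_mul, h0, mul_zero]
  have e1 : ∀ ω, centerOp n d (X (k + 2) ω) = p ω + -q ω := by
    intro ω
    rw [h.center_X_succ_succ hn hW.doublyStochastic]
    simp only [hp, hq, hS, hD, hv, hx, map_smul, map_sub, smul_sub, ← hAdef]
    -- The equation of s cancels the gradients at z, leaving the differences in D.
    have hs' : α • s - α • A s = α • A (A gz) := by rw [← smul_sub, hs]
    rw [← hs']
    abel
  have e2 : ∀ ω, S (k + 1) ω = t ω + q ω := by
    intro ω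
    simp only [ht, hq, hS, hD, hv, map_smul, map_sub, smul_sub, mixedSum, smul_add]
    have hs' : α • s - α • A s = α • A (A gz) := by rw [← smul_sub, hs]
    rw [← hs']
    abel
  have hvar : ∫ ω, ‖q ω‖ ^ 2 ∂P ≤ α ^ 2 * (n * σ ^ 2) := by
    have h1 : ∫ ω, ‖q ω‖ ^ 2 ∂P ≤ ∫ ω, α ^ 2 * ‖v ω‖ ^ 2 ∂P := by
      refine integral_mono (hq2.integrable_norm_pow two_ne_zero)
        (((h.memLp_noise (k + 1)).integrable_norm_pow two_ne_zero).const_mul _) fun ω => ?_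
      simp only [hq, norm_smul, mul_pow, Real.norm_eq_abs, sq_abs]
      have h2 : ‖A (A (v ω))‖ ≤ ‖v ω‖ := (hA.norm_le hlt.le _).trans (hA.norm_le hlt.le _)
      gcongr
    rw [integral_const_mul] at h1
    exact h1.trans (mul_le_mul_of_nonneg_left (h.variance (k + 1)) (sq_nonneg α))
  have i1 : Integrable (fun ω => ‖x ω‖ ^ 2) P := hx2.integrable_norm_pow two_ne_zero
  have i2 : Integrable (fun ω => ‖S k ω‖ ^ 2) P := hS2.integrable_norm_pow two_ne_zero
  have i3 : Integrable (fun ω => ‖avgOp n d (X (k + 1) ω) - z‖ ^ 2) P :=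
    (((avgOp n d).comp_memLp' hX).sub (memLp_const z)).integrable_norm_pow two_ne_zero
  have i4 : Integrable (fun ω => ‖p ω‖ ^ 2) P := hp2.integrable_norm_pow two_ne_zero
  have i5 : Integrable (fun ω => ‖t ω‖ ^ 2) P := ht2.integrable_norm_pow two_ne_zero
  -- The part of the gradient differences caused by disagreement costs at most half of the gap (1 −
  -- r)/4, which leaves the rate (1 − r)/8.
  have hcoef : 15 * L ^ 2 * (α ^ 2 / (1 - r)) ≤ (1 - r) / 8 := by
    have h1 : α ^ 2 / (1 - r) ≤ maxStep L μ ^ 2 * (1 - r) := by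
      rw [div_le_iff₀ hδ]
      calc α ^ 2 ≤ (maxStep L μ * (1 - r)) ^ 2 := pow_le_pow_left₀ hα.le hαδ 2
        _ = _ := by ring
    have h2 : L ^ 2 * maxStep L μ ^ 2 ≤ 1 / 4096 := by
      have h3 := mul_maxStep hμ hμL
      have h4 := mu_mul_maxStep_le hμ hμL
      calc L ^ 2 * maxStep L μ ^ 2 = μ / 64 * maxStep L μ := by rw [← h3]; ring
        _ ≤ _ := by linarith
    calc 15 * L ^ 2 * (α ^ 2 / (1 - r)) ≤ 15 * L ^ 2 * (maxStep L μ ^ 2 * (1 - r)) := by gcongr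
      _ = 15 * (L ^ 2 * maxStep L μ ^ 2) * (1 - r) := by ring
      _ ≤ 15 * (1 / 4096) * (1 - r) := by gcongr
      _ ≤ _ := by linarith
  have hpt : ∀ ω, ‖p ω‖ ^ 2 + 2 * ‖t ω‖ ^ 2
      ≤ (1 - (1 - r) / 8) * (‖x ω‖ ^ 2 + 2 * ‖S k ω‖ ^ 2)
        + n * (15 * L ^ 2 * (α ^ 2 / (1 - r)) * ‖avgOp n d (X (k + 1) ω) - z‖ ^ 2) := by
    intro ω
    have h1 := hA.lyapunov_perturbed_le hlt (x ω) (S k ω) (D ω)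
    have h2 : ‖D ω‖ ^ 2 ≤ α ^ 2 * (L ^ 2 * (‖x ω‖ ^ 2 + n * ‖avgOp n d (X (k + 1) ω) - z‖ ^ 2)) := by
      simp only [hD, norm_smul, mul_pow, Real.norm_eq_abs, sq_abs]
      refine mul_le_mul_of_nonneg_left ((norm_sq_stackGrad_sub_le hf _ _).trans (le_of_eq ?_))
        (sq_nonneg α)
      rw [hx, norm_sq_centerOp, avgOp_apply, ← sum_norm_sq_sub_eq hn, Stacked.norm_sq_eq]
      rfl
    have h3 : 15 / (1 - r) * ‖D ω‖ ^ 2 ≤ 15 * L ^ 2 * (α ^ 2 / (1 - r)) * ‖x ω‖ ^ 2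
        + n * (15 * L ^ 2 * (α ^ 2 / (1 - r)) * ‖avgOp n d (X (k + 1) ω) - z‖ ^ 2) := by
      calc _ ≤ 15 / (1 - r)
          * (α ^ 2 * (L ^ 2 * (‖x ω‖ ^ 2 + n * ‖avgOp n d (X (k + 1) ω) - z‖ ^ 2))) := by gcongr
        _ = _ := by ring
    have h4 := mul_le_mul_of_nonneg_right hcoef (sq_nonneg ‖x ω‖)
    have h5 : 0 ≤ (1 - r) * ‖S k ω‖ ^ 2 := by positivity
    linarith
  have hint := integral_mono (i4.add (i5.const_mul 2))
    (((i1.add (i2.const_mul 2)).const_mul (1 - (1 - r) / 8)).add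
      ((i3.const_mul (15 * L ^ 2 * (α ^ 2 / (1 - r)))).const_mul (n : ℝ))) hpt
  rw [integral_add' i4 (i5.const_mul 2), integral_const_mul,
    integral_add' ((i1.add (i2.const_mul 2)).const_mul (1 - (1 - r) / 8))
      ((i3.const_mul (15 * L ^ 2 * (α ^ 2 / (1 - r)))).const_mul (n : ℝ)),
    integral_const_mul, integral_const_mul, integral_const_mul,
    integral_add' i1 (i2.const_mul 2), integral_const_mul] at hint
  -- The noise counts once in the first component and twice in the second, whence the constant 3.
  have g1 := integral_norm_sq_add_of_orthogonal hp2 hq2.neg (by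
    simp only [Pi.neg_apply, inner_neg_right]
    rw [integral_neg, horth hpm hp2, neg_zero])
  have g2 := integral_norm_sq_add_of_orthogonal ht2 hq2 (horth htm ht2)
  simp only [Pi.neg_apply, norm_neg] at g1
  simp only [e1]
  change _ + 2 * ∫ ω, ‖S (k + 1) ω‖ ^ 2 ∂P ≤ _
  simp only [e2]
  rw [g1, g2]
  linarith

/-- The consensus Lyapunov function after one iteration. -/
lemma consensus_initial (h : IsNoisyTracking P m f W α σ x0 X Y G) (hn : 0 < n)
    (hW : IsGossipMatrix W) (hα : 0 < α) {c : ℝ} (hc : 0 ≤ c)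
    (hαδ : α ≤ c * (1 - mixingRate W)) (hf : ∀ i, IsSmoothStronglyConvex L μ (f i))
    {s : Stacked n d} (hs : (1 - mixingRate W) * ‖s‖
      ≤ ‖mixOp W (mixOp W (stackGrad f (Stacked.mk fun _ => z)))‖) {ς : ℝ}
    (hς : ς = 1 / (n : ℝ) * ∑ i, ‖gradient (f i) z‖ ^ 2) :
    ∫ ω, ‖centerOp n d (X 1 ω)‖ ^ 2 ∂P
        + 2 * ∫ ω, ‖α • (mixedSum (mixOp W) (fun t => G t ω) 0 - s)‖ ^ 2 ∂P
      ≤ n * (2 * α ^ 2 * σ ^ 2 + 4 * α ^ 2 * (L ^ 2 * ‖x0 - z‖ ^ 2 + ς) + 2 * c ^ 2 * ς) := by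
  have hA := isPosContraction_mixOp (d := d) hn hW
  have hlt := mixingRate_lt_one hn hW
  have hδ : 0 < 1 - mixingRate W := by linarith
  have hnR : (0 : ℝ) < n := by exact_mod_cast hn
  set gz : Stacked n d := stackGrad f (Stacked.mk fun _ => z) with hgz
  have hnς : ‖gz‖ ^ 2 = n * ς := by
    rw [hς, Stacked.norm_sq_eq, ← mul_assoc, mul_one_div_cancel hnR.ne', one_mul]
    simp only [hgz, stackGrad, Stacked.blocks_mk]
  set g0 : Stacked n d := stackGrad f (Stacked.mk fun _ => x0) with hg0
  have hg0z : ‖g0 - gz‖ ^ 2 ≤ n * (L ^ 2 * ‖x0 - z‖ ^ 2) := by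
    refine (norm_sq_stackGrad_sub_le hf _ _).trans (le_of_eq ?_)
    rw [Stacked.norm_sq_eq]
    simp only [Stacked.blocks_sub, Stacked.blocks_mk, Pi.sub_apply, Finset.sum_const,
      Finset.card_univ, Fintype.card_fin, nsmul_eq_mul]
    exact mul_left_comm _ _ _
  have htwo : ∀ a b : Stacked n d, ‖a + b‖ ^ 2 ≤ 2 * ‖a‖ ^ 2 + 2 * ‖b‖ ^ 2 := fun a b => by
    have := parallelogram_law_with_norm ℝ a b
    nlinarith [sq_nonneg ‖a - b‖]
  have hg0n : ‖g0‖ ^ 2 ≤ n * (2 * (L ^ 2 * ‖x0 - z‖ ^ 2 + ς)) := by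
    have := htwo (g0 - gz) gz
    rw [sub_add_cancel] at this
    linarith
  set v : Ω → Stacked n d := fun ω => G 0 ω - stackGrad f (X 0 ω) with hv
  have hv2 : Integrable (fun ω => ‖v ω‖ ^ 2) P :=
    (h.memLp_noise 0).integrable_norm_pow two_ne_zero
  have hpt : ∀ ω, ‖centerOp n d (X 1 ω)‖ ^ 2 ≤ α ^ 2 * (2 * ‖v ω‖ ^ 2 + 2 * ‖g0‖ ^ 2) := by
    intro ω
    have h0 : centerOp n d (X 0 ω) = 0 := by rw [h.X_zero, centerOp_const hn]
    rw [h.center_X_succ hn hW.doublyStochastic 0, h0, map_zero, zero_sub, norm_neg, norm_smul,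
      mul_pow, Real.norm_eq_abs, sq_abs, h.Y_zero]
    have h1 : G 0 ω = v ω + g0 := by simp only [hv, hg0, h.X_zero, sub_add_cancel]
    have h2 : ‖mixOp W (G 0 ω)‖ ^ 2 ≤ ‖G 0 ω‖ ^ 2 :=
      pow_le_pow_left₀ (norm_nonneg _) (hA.norm_le hlt.le _) 2
    rw [h1] at h2 ⊢
    exact mul_le_mul_of_nonneg_left (h2.trans (htwo _ _)) (sq_nonneg α)
  have hfirst : ∫ ω, ‖centerOp n d (X 1 ω)‖ ^ 2 ∂P
      ≤ α ^ 2 * (2 * (n * σ ^ 2) + 2 * ‖g0‖ ^ 2) := by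
    have h1 := integral_mono
      (((centerOp n d).comp_memLp' (h.memLp_X hf 1)).integrable_norm_pow two_ne_zero)
      (((hv2.const_mul 2).add (integrable_const (2 * ‖g0‖ ^ 2))).const_mul (α ^ 2)) hpt
    rw [integral_const_mul, integral_add' (hv2.const_mul 2) (integrable_const _),
      integral_const_mul] at h1
    simp only [integral_const, probReal_univ, one_smul] at h1
    have h2 := mul_le_mul_of_nonneg_left (h.variance 0) (by positivity : (0 : ℝ) ≤ α ^ 2 * 2)
    simp only [Function.comp_apply] at h1
    linarith
  have hsecond : ∫ ω, ‖α • (mixedSum (mixOp W) (fun t => G t ω) 0 - s)‖ ^ 2 ∂P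
      ≤ c ^ 2 * (n * ς) := by
    simp only [mixedSum, zero_sub, norm_smul, norm_neg, Real.norm_eq_abs, abs_of_pos hα,
      integral_const, probReal_univ, one_smul]
    rw [← hnς, ← mul_pow]
    refine pow_le_pow_left₀ (by positivity) ?_ 2
    have h1 : ‖mixOp W (mixOp W gz)‖ ≤ ‖gz‖ :=
      (hA.norm_le hlt.le _).trans (hA.norm_le hlt.le _)
    -- The stepsize bound pays for the factor 1/(1 − λ) in the size of s.
    calc α * ‖s‖ ≤ c * (1 - mixingRate W) * ‖s‖ := by gcongr
      _ = c * ((1 - mixingRate W) * ‖s‖) := by ring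
      _ ≤ c * ‖gz‖ := by gcongr; exact hs.trans h1
  have h3 := mul_le_mul_of_nonneg_left hg0n (by positivity : (0 : ℝ) ≤ α ^ 2 * 2)
  linarith

/-- The convergence rate of gradient tracking with a fixed stepsize. -/
theorem rate (h : IsNoisyTracking P m f W α σ x0 X Y G) (hn : 0 < n)
    (hW : IsGossipMatrix W) (hμ : 0 < μ) (hμL : μ ≤ L) (hα : 0 < α)
    (hαδ : α ≤ maxStep L μ * (1 - mixingRate W)) (hf : ∀ i, IsSmoothStronglyConvex L μ (f i))
    (hz : ∑ i, gradient (f i) z = 0) {ς : ℝ}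
    (hς : ς = 1 / (n : ℝ) * ∑ i, ‖gradient (f i) z‖ ^ 2) {K : ℕ} (hK : 1 ≤ K) :
    ∫ ω, ‖avgOp n d (X K ω) - z‖ ^ 2 ∂P
        + 1 / (n : ℝ) * ∫ ω, ‖centerOp n d (X K ω)‖ ^ 2 ∂P
      ≤ rateConst L μ * ((‖x0 - z‖ ^ 2 + ς) * (1 - α * μ / 2) ^ K + α * (σ ^ 2 / n)
        + α ^ 2 * (σ ^ 2 / (1 - mixingRate W))) := by
  have hA := isPosContraction_mixOp (d := d) hn hW
  have hlt := mixingRate_lt_one hn hW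
  have hδ : 0 < 1 - mixingRate W := by linarith
  have hδ1 : 1 - mixingRate W ≤ 1 := by linarith [hA.rate_nonneg]
  have hnR : (0 : ℝ) < n := by exact_mod_cast hn
  have hL : 0 < L := by linarith
  have hc := maxStep_pos hμ hμL
  have hς0 : 0 ≤ ς := by rw [hς]; positivity
  -- s is the stationary value of `mixedSum` when all gradients are frozen at z.
  obtain ⟨s, hs, hsn⟩ := hA.exists_preimage hlt
    (mixOp W (mixOp W (stackGrad f (Stacked.mk fun _ => z))))
  have hαL : 4 * L ^ 2 * α ≤ μ := by
    have h1 : α ≤ maxStep L μ := hαδ.trans (mul_le_of_le_one_right hc.le hδ1)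
    have h2 := mul_le_mul_of_nonneg_left h1 (sq_nonneg L)
    rw [mul_maxStep hμ hμL] at h2
    linarith
  set e : ℕ → ℝ := fun k => ∫ ω, ‖avgOp n d (X k ω) - z‖ ^ 2 ∂P with he
  -- The iterate at k is paired with the sum at k − 1, the latest sum known from x^0, …, x^k. The
  -- Lyapunov recursion is used only from k = 1, where the natural subtraction is not truncated.
  set V : ℕ → ℝ := fun k => ∫ ω, ‖centerOp n d (X k ω)‖ ^ 2 ∂P
    + 2 * ∫ ω, ‖α • (mixedSum (mixOp W) (fun t => G t ω) (k - 1) - s)‖ ^ 2 ∂P with hV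
  have hVge : ∀ k, ∫ ω, ‖centerOp n d (X k ω)‖ ^ 2 ∂P ≤ V k := fun k => by
    have : 0 ≤ ∫ ω, ‖α • (mixedSum (mixOp W) (fun t => G t ω) (k - 1) - s)‖ ^ 2 ∂P :=
      integral_nonneg fun _ => sq_nonneg _
    simp only [hV]; linarith
  have hstep := fun k => h.mean_recursion hn hW.doublyStochastic hμ hμL hα.le hαL hf hz k
  have hmain := tracking_rate (L := L) (μ := μ) hμ hμL (α := α) (δ := 1 - mixingRate W) (N := n)
    (s := σ ^ 2) (a := ‖x0 - z‖ ^ 2) (ς := ς) hα hδ hδ1 hαδ hnR (sq_nonneg σ) (sq_nonneg _) hς0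
    (e := e) (v := fun k => 1 / (n : ℝ) * V k)
    (fun k _ => (hstep k).trans (by
      have := hVge k
      gcongr))
    (fun k hk => by
      obtain ⟨j, rfl⟩ := Nat.exists_eq_add_of_le' hk
      have h1 := h.consensus_recursion hn hW hμ hμL hα hαδ hf hs j
      change V (j + 2) ≤ (1 - (1 - mixingRate W) / 8) * V (j + 1) + n * (_ * e (j + 1)) + _ at h1
      have h2 := mul_le_mul_of_nonneg_left h1 (by positivity : 0 ≤ 1 / (n : ℝ))
      refine h2.trans (le_of_eq ?_)
      field_simp)
    (by
      refine (hstep 0).trans (le_of_eq ?_)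
      simp only [h.X_zero, centerOp_const hn, norm_zero, avgOp_apply, Stacked.blocks_mk, blockAvg_const hn,
        integral_const, probReal_univ, one_smul]
      simp)
    (by
      have h1 := h.consensus_initial hn hW hα hc.le hαδ hf hsn hς
      have h2 := mul_le_mul_of_nonneg_left h1 (by positivity : 0 ≤ 1 / (n : ℝ))
      refine h2.trans (le_of_eq ?_)
      field_simp) hK
  refine le_trans ?_ hmain
  have := hVge K
  simp only [he]
  gcongr

end IsNoisyTracking

/-! ### From sampled data to the abstract noisy tracking process -/

lemma measurable_historySigma {n d : ℕ} {Ω : Type*} {x : ℕ → Ω → (Fin n → RVec d)} {t k : ℕ} (htk : t ≤ k) :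
    Measurable[historySigma x k] (x t) := by
  have h1 : Measurable[MeasurableSpace.comap (x t) inferInstance] (x t) := comap_measurable (x t)
  exact h1.mono (le_iSup₂ (f := fun t (_ : t ∈ Set.Iic k) =>
    MeasurableSpace.comap (x t) inferInstance) t htk) le_rfl

lemma historySigma_mono {n d : ℕ} {Ω : Type*} (x : ℕ → Ω → (Fin n → RVec d)) : Monotone (historySigma x) :=
  fun _ _ hkl => biSup_mono fun _ ht => le_trans ht hkl

lemma measurable_stochGrad_comp {d : ℕ} {Ω Ξ : Type*} [MeasurableSpace Ξ]
    {mD : MeasurableSpace Ω} {F : RVec d → Ξ → ℝ}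
    (hF : Measurable fun p : RVec d × Ξ => stochGrad F p.1 p.2) {y : Ω → RVec d}
    {s : Ω → Ξ} (hy : Measurable[mD] y) (hs : Measurable[mD] s) :
    Measurable[mD] (fun ω => stochGrad F (y ω) (s ω)) :=
  hF.comp (hy.prodMk hs)

/-- Pairwise independence of the data, extracted from mutual conditional independence. -/
lemma CondIndepGiven.pair {n : ℕ} {Ξ : Fin n → Type*} [∀ i, MeasurableSpace (Ξ i)] {Ω : Type*}
    {m mΩ : MeasurableSpace Ω} {P : Measure Ω} {X : ∀ i, Ω → Ξ i}
    (h : CondIndepGiven m P X) {i j : Fin n} (hij : i ≠ j) {A : Set (Ξ i)} {B : Set (Ξ j)}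
    (hA : MeasurableSet A) (hB : MeasurableSet B) :
    P[(X i ⁻¹' A ∩ X j ⁻¹' B).indicator (fun _ => (1 : ℝ)) | m]
      =ᵐ[P] P[(X i ⁻¹' A).indicator (fun _ => (1 : ℝ)) | m]
        * P[(X j ⁻¹' B).indicator (fun _ => (1 : ℝ)) | m] := by
  classical
  let T : ∀ l, Set (Ξ l) := Function.update (Function.update (fun _ => Set.univ) j B) i A
  have hTi : T i = A := Function.update_self ..
  have hTj : T j = B := by
    simp only [T, Function.update_of_ne hij.symm, Function.update_self]
  have := h {i, j} T (by
    intro l hl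
    rcases Finset.mem_insert.1 hl with rfl | hl
    · rwa [hTi]
    · rw [Finset.mem_singleton.1 hl, hTj]; exact hB)
  rw [Finset.prod_pair hij, hTi, hTj] at this
  simpa [hTi, hTj] using this

section Instantiation

variable {n d : ℕ} {Ξ : Fin n → Type*} [∀ i, MeasurableSpace (Ξ i)]
  {Ω : Type*} [mΩ : MeasurableSpace Ω] {P : Measure Ω}
  {W : Matrix (Fin n) (Fin n) ℝ} {α σ L μ : ℝ} {F : ∀ i, RVec d → Ξ i → ℝ}
  {f : Fin n → RVec d → ℝ} {x0 : RVec d} {ξ : ∀ i, ℕ → Ω → Ξ i}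

lemma historySigma_le {x : ℕ → Ω → (Fin n → RVec d)} (hx : ∀ k, Measurable (x k)) (k : ℕ) :
    historySigma x k ≤ mΩ :=
  iSup₂_le fun t _ => (hx t).comap_le

lemma measurable_atcGT (hF : ∀ i, Measurable fun p : RVec d × Ξ i => stochGrad (F i) p.1 p.2)
    (hξ : ∀ i k, Measurable (ξ i k)) (x0 : Fin n → RVec d) (k : ℕ) :
    Measurable (fun ω => (atcGT W α F x0 (fun i t => ξ i t ω) k).1) ∧
      Measurable (fun ω => (atcGT W α F x0 (fun i t => ξ i t ω) k).2) := by
  have hgrad : ∀ {y : Ω → Fin n → RVec d}, Measurable y → ∀ i k,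
      Measurable (fun ω => stochGrad (F i) (y ω i) (ξ i k ω)) := fun hy i k =>
    measurable_stochGrad_comp (hF i) ((measurable_pi_apply i).comp hy) (hξ i k)
  induction k with
  | zero =>
    exact ⟨measurable_const, measurable_pi_lambda _ fun i => hgrad measurable_const i 0⟩
  | succ k ih =>
    obtain ⟨ih₁, ih₂⟩ := ih
    have c₁ := fun j => (measurable_pi_apply j).comp ih₁
    have c₂ := fun j => (measurable_pi_apply j).comp ih₂
    have hx : Measurable (fun ω => (atcGT W α F x0 (fun i t => ξ i t ω) (k + 1)).1) :=
      measurable_pi_lambda _ fun i => Finset.measurable_sum (f := fun j ω => W i j •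
        ((atcGT W α F x0 (fun i t => ξ i t ω) k).1 j
          - α • (atcGT W α F x0 (fun i t => ξ i t ω) k).2 j)) Finset.univ fun j _ =>
        (((c₁ j).sub ((c₂ j).const_smul α)).const_smul (W i j))
    exact ⟨hx, measurable_pi_lambda _ fun i => Finset.measurable_sum (f := fun j ω => W i j •
      ((atcGT W α F x0 (fun i t => ξ i t ω) k).2 j
        + stochGrad (F j) ((atcGT W α F x0 (fun i t => ξ i t ω) (k + 1)).1 j) (ξ j (k + 1) ω)
        - stochGrad (F j) ((atcGT W α F x0 (fun i t => ξ i t ω) k).1 j) (ξ j k ω))) Finset.univ fun j _ =>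
      ((((c₂ j).add (hgrad hx j (k + 1))).sub (hgrad ih₁ j k)).const_smul (W i j))⟩

lemma norm_sq_sum_eq {E ι : Type*} [NormedAddCommGroup E] [InnerProductSpace ℝ E] (s : Finset ι)
    (u : ι → E) : ‖∑ i ∈ s, u i‖ ^ 2 = ∑ i ∈ s, ∑ j ∈ s, inner ℝ (u i) (u j) := by
  rw [← real_inner_self_eq_norm_sq, sum_inner]
  simp only [inner_sum]

/-- The gradient-tracking method with random data is a noisy tracking process. -/
lemma isNoisyTracking_of_gradientNoise [IsProbabilityMeasure P] (hn : 0 < n)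
    (hf : ∀ i, IsSmoothStronglyConvex L μ (f i))
    (hF : ∀ i, Measurable fun p : RVec d × Ξ i => stochGrad (F i) p.1 p.2)
    (hξ : ∀ i k, Measurable (ξ i k))
    (hnoise : GradientNoise P f F (gtIterate W α F (fun _ => x0) ξ) ξ σ) :
    IsNoisyTracking P (historySigma (gtIterate W α F (fun _ => x0) ξ)) f W α σ x0
      (fun k ω => Stacked.mk (gtIterate W α F (fun _ => x0) ξ k ω))
      (fun k ω => Stacked.mk (atcGT W α F (fun _ => x0) (fun i t => ξ i t ω) k).2)
      (fun k ω => Stacked.mk fun i =>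
        stochGrad (F i) (gtIterate W α F (fun _ => x0) ξ k ω i) (ξ i k ω)) := by
  set x := gtIterate W α F (fun _ => x0) ξ with hx
  have hxm : ∀ k, Measurable (x k) := fun k => (measurable_atcGT hF hξ _ k).1
  have hle : ∀ k, historySigma x k ≤ mΩ := historySigma_le hxm
  set v : Fin n → ℕ → Ω → RVec d := fun i k ω =>
    stochGrad (F i) (x k ω i) (ξ i k ω) - gradient (f i) (x k ω i) with hv
  have hv2 : ∀ i k, MemLp (v i k) 2 P := hnoise.memLp
  have hv0 : ∀ i k, P[v i k | historySigma x k] =ᵐ[P] 0 := hnoise.unbiased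
  have hsub : ∀ k ω, (Stacked.mk fun i => stochGrad (F i) (x k ω i) (ξ i k ω))
      - stackGrad f (Stacked.mk (x k ω)) = Stacked.mk fun i => v i k ω := fun k ω => rfl
  have hxi : ∀ k i, Measurable[historySigma x k] (fun ω => x k ω i) := fun k i =>
    (measurable_pi_apply i).comp (measurable_historySigma le_rfl)
  have hvar : ∀ i k, ∫ ω, ‖v i k ω‖ ^ 2 ∂P ≤ σ ^ 2 := fun i k => by
    rw [← integral_condExp (hle k)]
    calc _ ≤ ∫ _ω, σ ^ 2 ∂P :=
          integral_mono_ae integrable_condExp (integrable_const _) (hnoise.variance_le i k)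
      _ = σ ^ 2 := by simp
  have hint : ∀ i k, Integrable (fun ω => ‖v i k ω‖ ^ 2) P := fun i k =>
    (hv2 i k).integrable_norm_pow two_ne_zero
  have hvm : ∀ i k, StronglyMeasurable[historySigma x k ⊔ MeasurableSpace.comap (ξ i k) inferInstance]
      (v i k) := fun i k => by
    have h1 : Measurable[historySigma x k ⊔ MeasurableSpace.comap (ξ i k) inferInstance]
        (fun ω => x k ω i) := (hxi k i).mono le_sup_left le_rfl
    have h2 : Measurable[historySigma x k ⊔ MeasurableSpace.comap (ξ i k) inferInstance] (ξ i k) :=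
      (comap_measurable (ξ i k)).mono le_sup_right le_rfl
    exact ((measurable_stochGrad_comp (hF i) h1 h2).sub
      ((hf i).continuous_gradient.measurable.comp h1)).stronglyMeasurable
  have hcross : ∀ k i j, i ≠ j → ∫ ω, inner ℝ (v i k ω) (v j k ω) ∂P = 0 := fun k i j hij =>
    integral_inner_eq_zero_of_condIndep (hle k) (hξ i k) (hξ j k)
      (fun A B hA hB => (hnoise.condIndep k).pair hij hA hB) (hvm i k) (hvm j k) (hv2 i k)
      (hv2 j k) (hv0 j k)
  have hmem : ∀ k, MemLp (fun ω => Stacked.mk fun i => v i k ω) 2 P := fun k =>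
    MemLp.of_eval_piLp (f := fun ω => (WithLp.toLp 2 fun i => v i k ω : PiLp 2 fun _ : Fin n => RVec d))
      fun i => hv2 i k
  have hnR : (0 : ℝ) < n := by exact_mod_cast hn
  have hsum : ∀ k, ∫ ω, ‖Stacked.mk fun i => v i k ω‖ ^ 2 ∂P ≤ n * σ ^ 2 := fun k => by
    simp only [Stacked.norm_sq_eq, Stacked.blocks_mk]
    rw [integral_finsetSum _ fun i _ => hint i k]
    calc _ ≤ ∑ _i : Fin n, σ ^ 2 := Finset.sum_le_sum fun i _ => hvar i k
      _ = n * σ ^ 2 := by simp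
  refine
    { X_zero := fun ω => rfl
      Y_zero := fun ω => rfl
      X_succ := fun k ω => rfl
      Y_succ := fun k ω => rfl
      mono := historySigma_mono x
      le := hle
      meas_X := fun k => ?_
      memLp_noise := fun k => ?_
      orthogonal := fun k a ham ha2 => ?_
      variance := fun k => ?_
      variance_avg := fun k => ?_ }
  · exact (Stacked.measurable_mk.comp (measurable_historySigma le_rfl)).stronglyMeasurable
  · simp only [hsub]
    exact hmem k
  · simp only [hsub, Stacked.inner_eq, Stacked.blocks_mk]
    have hai : ∀ i, MemLp (fun ω => (a ω).blocks i) 2 P := fun i =>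
      MemLp.eval_piLp (E := fun _ : Fin n => RVec d) (f := a) ha2 i
    have hami : ∀ i, StronglyMeasurable[historySigma x k] (fun ω => (a ω).blocks i) := fun i =>
      ((continuous_apply i).comp Stacked.continuous_blocks).comp_stronglyMeasurable ham
    rw [integral_finsetSum _ fun i _ => integrable_inner_of_memLp (hai i) (hv2 i k)]
    exact Finset.sum_eq_zero fun i _ => integral_inner_eq_zero_of_condExp_eq_zero (hle k)
      (hami i) (hai i) (hv2 i k) (hv0 i k)
  · simp only [hsub]
    exact hsum k
  · simp only [hsub, avgOp_apply, Stacked.blocks_mk, blockAvg, norm_smul, mul_pow, norm_sq_sum_eq]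
    rw [integral_const_mul, integral_finsetSum _ fun i _ => integrable_finsetSum _ fun j _ =>
      integrable_inner_of_memLp (hv2 i k) (hv2 j k)]
    -- Only the diagonal survives, so the squared norm of the noise average costs n variances
    -- divided by n².
    have h1 : ∀ i, ∫ ω, ∑ j, inner ℝ (v i k ω) (v j k ω) ∂P = ∫ ω, ‖v i k ω‖ ^ 2 ∂P := fun i => by
      rw [integral_finsetSum _ fun j _ => integrable_inner_of_memLp (hv2 i k) (hv2 j k),
        Finset.sum_eq_single i (fun j _ hj => hcross k i j hj.symm) (by simp)]
      simp only [real_inner_self_eq_norm_sq]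
    simp only [h1]
    calc _ ≤ ‖1 / (n : ℝ)‖ ^ 2 * ∑ _i : Fin n, σ ^ 2 := by
          gcongr with i; exact hvar i k
      _ = σ ^ 2 / n := by
          simp
          field_simp

end Instantiation

end

/-! ### The final bound -/

theorem theorem2 (L μ : ℝ) (hμ : 0 < μ) (hμL : μ ≤ L) :
    ∃ C > (0 : ℝ), ∃ c > (0 : ℝ),
      ∀ (n d : ℕ) (_hn : 0 < n)
        (Ξ : Fin n → Type*) [∀ i, MeasurableSpace (Ξ i)]
        (D : ∀ i, Measure (Ξ i)) [∀ i, IsProbabilityMeasure (D i)]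
        (F : ∀ i, RVec d → Ξ i → ℝ) (_hF : ∀ i, IsStochasticLoss (D i) (F i))
        (f : Fin n → RVec d → ℝ) (_hf : ∀ i, f i = localCost (D i) (F i))
        (_hfL : ∀ i, IsSmoothStronglyConvex L μ (f i))
        (W : Matrix (Fin n) (Fin n) ℝ) (_hW : IsGossipMatrix W)
        (xstar : RVec d)
        (_hstar : IsMinOn (fun x => (1 / (n : ℝ)) * ∑ i, f i x) Set.univ xstar)
        (x0 : RVec d) (σ : ℝ) (_hσ : 0 ≤ σ)
        (a₀ : ℝ) (_ha₀ : a₀ = ‖x0 - xstar‖ ^ 2)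
        (ςsq : ℝ) (_hς : ςsq = (1 / (n : ℝ)) * ∑ i, ‖gradient (f i) xstar‖ ^ 2)
        (K : ℕ) (_hK : 1 ≤ K),
        ∃ α > (0 : ℝ),
          ∀ (Ω : Type*) [MeasurableSpace Ω] (P : Measure Ω) [IsProbabilityMeasure P]
            (ξ : ∀ i, ℕ → Ω → Ξ i) (_hξ : ∀ i k, Measurable (ξ i k))
            (x : ℕ → Ω → (Fin n → RVec d)) (_hx : x = gtIterate W α F (fun _ => x0) ξ)
            (_hnoise : GradientNoise P f F x ξ σ),
            Integrable (fun ω => ‖blockAvg (x K ω) - xstar‖ ^ 2) P ∧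
            Integrable (fun ω => consensusErrorSq (x K ω)) P ∧
            (∫ ω, ‖blockAvg (x K ω) - xstar‖ ^ 2 ∂P)
                + (1 / (n : ℝ)) * ∫ ω, consensusErrorSq (x K ω) ∂P
              ≤ C * (gtLogFactor n K σ a₀ ςsq * (σ ^ 2 / (n * K))
                  + gtLogFactor n K σ a₀ ςsq ^ 2 * (σ ^ 2 / ((1 - mixingRate W) * K ^ 2))
                  + gtLogFactor n K σ a₀ ςsq ^ 3 *
                      (σ ^ 2 / ((1 - mixingRate W) ^ 2 * n * K ^ 3))
                  + (a₀ + ςsq) * Real.exp (-(c * (1 - mixingRate W) * K))) := by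
  refine ⟨tuneConst μ * rateConst L μ, mul_pos (tuneConst_pos hμ) (rateConst_pos hμ hμL),
    maxStep L μ * μ / 2, by have := maxStep_pos hμ hμL; positivity, ?_⟩
  intro n d hn Ξ _ D _ F hF f hf hfL W hW z hstar x0 σ hσ a₀ ha₀ ςsq hς K hK
  have hδ : 0 < 1 - mixingRate W := sub_pos.2 (mixingRate_lt_one hn hW)
  have hδ1 : 1 - mixingRate W ≤ 1 := sub_le_self _ (norm_nonneg _)
  have ha0 : 0 ≤ a₀ := ha₀ ▸ sq_nonneg _
  have hς0 : 0 ≤ ςsq := hς ▸ mul_nonneg (by positivity) (Finset.sum_nonneg fun _ _ => sq_nonneg _)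
  -- The stepsize depends only on deterministic quantities, so it is fixed before the probability
  -- space and the data.
  obtain ⟨α, hα, hαδ, hbound⟩ := exists_stepsize (L := L) hμ hμL hn hK hδ hδ1 hσ ha0 hς0
  refine ⟨α, hα, fun Ω _ P _ ξ hξ x hx hnoise => ?_⟩
  subst hx
  have hproc := isNoisyTracking_of_gradientNoise hn hfL (fun i => (hF i).measurable_grad) hξ hnoise
  have hrate := hproc.rate hn hW hμ hμL hα hαδ hfL
    (sum_gradient_eq_zero_of_isMinOn hn hfL hstar) hς hK
  have hX := hproc.memLp_X hfL K
  have i1 := (((avgOp n d).comp_memLp' hX).sub (memLp_const z)).integrable_norm_pow two_ne_zero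
  have i2 := ((centerOp n d).comp_memLp' hX).integrable_norm_pow two_ne_zero
  simp only [Function.comp_apply, norm_sq_centerOp] at i2 hrate
  refine ⟨i1, i2, hrate.trans ?_⟩
  rw [← ha₀, mul_comm (tuneConst μ), mul_assoc]
  exact mul_le_mul_of_nonneg_left hbound (rateConst_pos hμ hμL).le
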